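/- Let $\mathbb{K}=\mathbb{R}$ or $\mathbb{C}$. A quasi-Banach sequence space is a linear space $E$ of sequences $(x_n)_{n\ge 0}$ in $\mathbb{K}$ with a complete quasi-norm $\|\cdot\|_E$ such that $f\in E$ and $|g|\le|f|$ (pointwise) imply $g\in E$ and $\|g\|_E\le\|f\|_E$. For such spaces (or $\ell^p$-spaces, $0<p<\infty$) $X,Y,Z$, the space $Z$ is an interpolation space for the couple $(X,Y)$ if $X\cap Y\subset Z\subset X+Y$ and every linear operator $T:X+Y\to X+Y$ that restricts to a bounded operator $X\to X$ and to a bounded operator $Y\to Y$ also restricts to a bounded operator $Z\to Z$. For a bounded sequence $w$ put $\mu(t,w)=\inf\{s\ge 0:\ \#\{n:|w_n|>s\}\le t\}$, $t>0$, and for bounded sequences $w,z$ write $w\prec\prec_{tl}z$ if $\int_t^\infty\mu(s,w)\,ds\le\int_t^\infty\mu(s,z)\,ds$ for all $t>0$, the integrals being taken in $[0,\infty]$. Let $E\subset\ell_\infty$ be a quasi-Banach sequence space with $E\neq\{0\}$ and $E\neq\ell_\infty$, and let $1\le q<\infty$. The following conditions are equivalent: (a) there exists $p$ with $0<p<q$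 such that $E$ is an interpolation space for the couple $(\ell^p,\ell^q)$; (b) there exists $c>0$ such that for all $u\in E$ and $v\in\ell_\infty$, $|v|^q\prec\prec_{tl}|u|^q$ implies $v\in E$ and $\|v\|_E\le c\|u\|_E$; (c) for all $u\in E$ and $v\in\ell_\infty$, $|v|^q\prec\prec_{tl}|u|^q$ implies $v\in E$. -/

import Mathlib

open scoped ENNReal

noncomputable section

namespace SeqInterp

/-- A linear space of scalar sequences together with a real-valued function on it
(the candidate quasi-norm). -/
structure NormedSeqSpace (𝕜 : Type*) [RCLike 𝕜] where
  carrier : Submodule 𝕜 (ℕ → 𝕜)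
  qnorm : carrier → ℝ

/-- `E` is a quasi-Banach sequence space: `qnorm` is a complete quasi-norm, and `E` is solid,
i.e. `|g| ≤ |f|` pointwise with `f ∈ E` gives `g ∈ E` and `‖g‖ ≤ ‖f‖`. -/
structure NormedSeqSpace.IsQuasiBanach {𝕜 : Type*} [RCLike 𝕜] (E : NormedSeqSpace 𝕜) : Prop where
  nonneg : ∀ x, 0 ≤ E.qnorm x
  eq_zero_iff : ∀ x, E.qnorm x = 0 ↔ x = 0
  smul : ∀ (a : 𝕜) (x), E.qnorm (a • x) = ‖a‖ * E.qnorm x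
  add_le : ∃ C : ℝ, ∀ x y, E.qnorm (x + y) ≤ C * (E.qnorm x + E.qnorm y)
  complete : ∀ f : ℕ → E.carrier,
    (∀ ε > 0, ∃ N, ∀ m ≥ N, ∀ n ≥ N, E.qnorm (f m - f n) < ε) →
      ∃ x, Filter.Tendsto (fun n => E.qnorm (f n - x)) Filter.atTop (nhds 0)
  solid : ∀ (f : E.carrier) (g : ℕ → 𝕜), (∀ n, ‖g n‖ ≤ ‖(f : ℕ → 𝕜) n‖) →
    ∃ hg : g ∈ E.carrier, E.qnorm ⟨g, hg⟩ ≤ E.qnorm f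

/-- The sequence space `ℓ^p` with Mathlib's (quasi-)norm. -/
def ellp (𝕜 : Type*) [RCLike 𝕜] (p : ℝ≥0∞) : NormedSeqSpace 𝕜 where
  carrier :=
    { carrier := {x | Memℓp x p}
      add_mem' := fun hx hy => hx.add hy
      zero_mem' := zero_memℓp
      smul_mem' := fun a _ hx => hx.const_smul a }
  qnorm := fun x => ‖(⟨x.1, x.2⟩ : lp (fun _ : ℕ => 𝕜) p)‖

/-- A linear operator `T` defined on a space `V` of sequences restricts to a bounded operator
from `Z` to `Z`. -/
def RestrictsBounded {𝕜 : Type*} [RCLike 𝕜] {V : Submodule 𝕜 (ℕ → 𝕜)} (T : V →ₗ[𝕜] V)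
    (Z : NormedSeqSpace 𝕜) : Prop :=
  ∃ C : ℝ, ∀ (x : V) (hx : (x : ℕ → 𝕜) ∈ Z.carrier),
    ∃ hT : (T x : ℕ → 𝕜) ∈ Z.carrier, Z.qnorm ⟨T x, hT⟩ ≤ C * Z.qnorm ⟨x, hx⟩

/-- `Z` is an interpolation space for the couple `(X, Y)`: `X ∩ Y ⊆ Z ⊆ X + Y`, and every linear
operator on `X + Y` that restricts to bounded operators on `X` and on `Y` also restricts to a
bounded operator on `Z`. -/
def IsInterpolationSpace {𝕜 : Type*} [RCLike 𝕜] (X Y Z : NormedSeqSpace 𝕜) : Prop :=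
  X.carrier ⊓ Y.carrier ≤ Z.carrier ∧ Z.carrier ≤ X.carrier ⊔ Y.carrier ∧
    ∀ T : ↥(X.carrier ⊔ Y.carrier) →ₗ[𝕜] ↥(X.carrier ⊔ Y.carrier),
      RestrictsBounded T X → RestrictsBounded T Y → RestrictsBounded T Z

/-- The right-continuous decreasing rearrangement
`μ(t, f) = inf {s ≥ 0 : m {|f| > s} ≤ t}` of a function on a measure space. -/
def rearrangement {Ω : Type*} [MeasurableSpace Ω] (m : MeasureTheory.Measure Ω) (f : Ω → ℝ)
    (t : ℝ) : ℝ≥0∞ :=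
  sInf {s : ℝ≥0∞ | m {x | s < ‖f x‖ₑ} ≤ ENNReal.ofReal t}

/-- Tail majorization of `g` by `f`: `∫_t^∞ μ(s, g) ds ≤ ∫_t^∞ μ(s, f) ds` for every `t > 0`,
the integrals being taken in `[0, ∞]`. -/
def TailMajorized {Ω : Type*} [MeasurableSpace Ω] (m : MeasureTheory.Measure Ω)
    (g f : Ω → ℝ) : Prop :=
  ∀ t : ℝ, 0 < t →
    ∫⁻ s in Set.Ioi t, rearrangement m g s ≤ ∫⁻ s in Set.Ioi t, rearrangement m f s

/-- `|v|^q` is tail majorized by `|u|^q`, for sequences, i.e. functions on `ℕ` with the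
counting measure. -/
def TailMajorizedPow {𝕜 : Type*} [RCLike 𝕜] (q : ℝ) (v u : ℕ → 𝕜) : Prop :=
  TailMajorized MeasureTheory.Measure.count (fun n => ‖v n‖ ^ q) (fun n => ‖u n‖ ^ q)

end SeqInterp

end

/-! For sequences, tail majorization has a combinatorial form, `TailDominated`: whatever finite set
is deleted from the larger sequence, deleting no more terms from the smaller one leaves a sum at
most as big. This form passes to subsequences, spreadings and direct sums without sorting.

(a) ⇒ (c). Sort `u`, `v` into decreasing `a`, `b`. The numbers `b j ^ q` and `a k ^ q` are lengths
of consecutive intervals cut out by the tail sums, with `B n ≤ A n`. The overlap lengths give a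
nonnegative matrix sending `a` to `b` (`exists_transport_matrix`). Once each `b j` not exceeding `a
j` is replaced by `0`, overlapping indices satisfy `a k ≤ b j`, and this makes the matrix bounded on
`ℓ^r` for all `0 < r ≤ q`. Interpolation puts the truncated `b` in `E`; the discarded terms lie
below `a`.

(c) ⇒ (b). A gliding hump: pairs violating every constant are placed on disjoint copies of `ℕ`
inside `ℕ`, completeness glues them into one pair of sequences, and closedness for that pair
contradicts the violation.

(b) ⇒ (a). An element of `E` outside `ℓ^q` would tail-dominate every bounded sequence, so `E ≠ ℓ_∞`
forces `E ⊆ ℓ^q`. The dilations `u (k / 2 ^ j)` have quasi-norm at most `L ^ j ‖u‖`, so a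
geometrically damped family of them has a majorant `y ∈ E`. For small `p`, the `p`-averages of a
decreasing `a ∈ E` are then bounded pointwise by `y` (`exists_exponent_average_bound`). If `T` is
bounded on `ℓ^p` and `ℓ^q`, split `u` into its `n` largest terms and the rest: a weak-type estimate
for the first part and the `ℓ^q` bound for the second show that `T u` is tail dominated by a
multiple of `y`. -/

namespace SeqInterp

open MeasureTheory Filter Topology

/-! ### Decreasing enumerations and sums after finite deletions -/

/-- A sequence in `[0, ∞]` tending to `0` can be enumerated in decreasing order. -/
theorem exists_decreasing_enumeration (φ : ℕ → ℝ≥0∞) (h : ∀ ε > 0, {k | ε ≤ φ k}.Finite) :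
    ∃ σ : ℕ → ℕ, Function.Injective σ ∧ Antitone (φ ∘ σ) ∧ ∀ k, k ∉ Set.range σ → φ k = 0 := by
  classical
  have step : ∀ F : Finset ℕ, ∃ m, m ∉ F ∧ ∀ k, k ∉ F → φ k ≤ φ m := by
    intro F
    by_cases hz : ∀ k, k ∉ F → φ k = 0
    · obtain ⟨m, hm⟩ := Infinite.exists_notMem_finset F
      exact ⟨m, hm, fun k hk => by simp [hz k hk]⟩
    · push Not at hz
      obtain ⟨m₀, hm₀, hpos⟩ := hz
      have hfin := (h (φ m₀) (pos_iff_ne_zero.2 hpos)).inter_of_left {k | k ∉ F}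
      obtain ⟨m, hm, hmax⟩ := Set.exists_max_image _ φ hfin ⟨m₀, le_refl (φ m₀), hm₀⟩
      refine ⟨m, hm.2, fun k hk => ?_⟩
      rcases le_total (φ m₀) (φ k) with hle | hle
      · exact hmax k ⟨hle, hk⟩
      · exact hle.trans hm.1
  choose g hg hmax using step
  -- Greedy choice: `S n` collects the first `n` indices, and `g` picks a maximizer outside it.
  let S : ℕ → Finset ℕ := fun n => Nat.rec ∅ (fun _ F => insert (g F) F) n
  have hS : ∀ n, S (n + 1) = insert (g (S n)) (S n) := fun n => rfl
  have hmono : Monotone S := monotone_nat_of_le_succ fun n => by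
    rw [hS]; exact Finset.subset_insert _ _
  have hlt : ∀ m n, m < n → g (S m) ≠ g (S n) := fun m n hmn he => by
    have : g (S m) ∈ S n := hmono (Nat.succ_le_of_lt hmn) (by
      change g (S m) ∈ S (m + 1)
      rw [hS]; exact Finset.mem_insert_self _ _)
    exact hg (S n) (he ▸ this)
  have hinj : Function.Injective fun n => g (S n) := by
    intro m n hmn
    by_contra hne
    rcases lt_or_gt_of_ne hne with hl | hl
    · exact hlt _ _ hl hmn
    · exact hlt _ _ hl hmn.symm
  refine ⟨fun n => g (S n), hinj, antitone_nat_of_succ_le fun n => ?_, fun k hk => ?_⟩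
  · exact hmax (S n) _ fun hmem => hg (S (n + 1)) (hmono (Nat.le_succ n) hmem)
  · have hkS : ∀ n, k ∉ S n := by
      intro n
      induction n with
      | zero => simp [S]
      | succ n ih =>
        rw [hS, Finset.mem_insert, not_or]
        exact ⟨fun he => hk ⟨n, he.symm⟩, ih⟩
    -- A nonzero term never chosen would lie below every chosen term, contradicting finiteness of
    -- its superlevel set.
    by_contra hne
    refine (Set.infinite_range_of_injective hinj) ((h (φ k) (pos_iff_ne_zero.2 hne)).subset ?_)
    rintro _ ⟨n, rfl⟩
    exact hmax (S n) k (hkS n)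

/-- The sum of `φ` over the complement of a finite set. -/
noncomputable def sumOff (φ : ℕ → ℝ≥0∞) (F : Finset ℕ) : ℝ≥0∞ :=
  ∑' k, ((F : Set ℕ)ᶜ).indicator φ k

/-- Combinatorial form of tail majorization: whatever remains of `φ` after deleting finitely many
terms dominates what remains of `ψ` after deleting at most as many suitable terms. -/
def TailDominated (ψ φ : ℕ → ℝ≥0∞) : Prop :=
  ∀ F : Finset ℕ, ∃ F' : Finset ℕ, F'.card ≤ F.card ∧ sumOff ψ F' ≤ sumOff φ F

theorem sumOff_empty (φ : ℕ → ℝ≥0∞) : sumOff φ ∅ = ∑' k, φ k := by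
  simp [sumOff]

theorem sum_add_sumOff (φ : ℕ → ℝ≥0∞) (F : Finset ℕ) :
    ∑ k ∈ F, φ k + sumOff φ F = ∑' k, φ k := by
  rw [sumOff, ← tsum_subtype ((F : Set ℕ)ᶜ) φ]
  exact ENNReal.sum_add_tsum_compl F φ

theorem sum_range_add_tsum_nat_add (f : ℕ → ℝ≥0∞) (n : ℕ) :
    ∑ i ∈ Finset.range n, f i + ∑' i, f (n + i) = ∑' i, f i := by
  simp_rw [add_comm n]
  exact Summable.sum_add_tsum_nat_add' ENNReal.summable

theorem sumOff_mono {φ ψ : ℕ → ℝ≥0∞} (h : ∀ k, φ k ≤ ψ k) (F : Finset ℕ) :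
    sumOff φ F ≤ sumOff ψ F :=
  ENNReal.tsum_le_tsum fun _ => Set.indicator_le_indicator (h _)

theorem sumOff_le_tsum (φ : ℕ → ℝ≥0∞) (F : Finset ℕ) : sumOff φ F ≤ ∑' k, φ k :=
  ENNReal.tsum_le_tsum fun _ => Set.indicator_le_self _ _ _

theorem tsum_eq_tsum_comp_of_injective {φ : ℕ → ℝ≥0∞} {σ : ℕ → ℕ} (hσ : Function.Injective σ)
    (h0 : ∀ k, k ∉ Set.range σ → φ k = 0) : ∑' k, φ k = ∑' i, φ (σ i) :=
  (hσ.tsum_eq fun k hk => by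
    by_contra hn
    exact hk (h0 k hn)).symm

theorem sumOff_image_range {φ : ℕ → ℝ≥0∞} {σ : ℕ → ℕ}
    (hσ : Function.Injective σ) (h0 : ∀ k, k ∉ Set.range σ → φ k = 0) (n : ℕ) :
    sumOff φ ((Finset.range n).image σ) = ∑' i, φ (σ (n + i)) := by
  classical
  rw [sumOff, tsum_eq_tsum_comp_of_injective hσ (fun k hk => by simp [Set.indicator, h0 k hk]),
    ← sum_range_add_tsum_nat_add _ n, Finset.sum_eq_zero, zero_add]
  · refine tsum_congr fun i => ?_
    rw [Set.indicator_of_mem]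
    simp [hσ.eq_iff]
  · intro i hi
    rw [Set.indicator_of_notMem]
    simpa [hσ.eq_iff] using hi

/-- Exchange argument: deleting the first `n` terms is optimal, because those of them outside `G`
are at least `x n`, while the terms of `G` beyond them are at most `x n` and no more numerous. -/
theorem tsum_nat_add_le_sumOff {x : ℕ → ℝ≥0∞} (hx : Antitone x) {n : ℕ} {G : Finset ℕ}
    (hG : G.card ≤ n) : ∑' i, x (n + i) ≤ sumOff x G := by
  classical
  have e1 : ∑' i, x (n + i) = sumOff x (Finset.range n) := by
    simpa using (sumOff_image_range (φ := x) Function.injective_id (by simp) n).symm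
  have split : ∀ A B : Finset ℕ, sumOff x A = ∑ k ∈ B \ A, x k + sumOff x (A ∪ B) := by
    intro A B
    have hdec : ((A : Set ℕ)ᶜ).indicator x = fun k => (((B \ A : Finset ℕ) : Set ℕ)).indicator x k +
        (((A ∪ B : Finset ℕ) : Set ℕ)ᶜ).indicator x k := by
      funext k
      by_cases hA : k ∈ A <;> by_cases hB : k ∈ B <;> simp [Set.indicator, hA, hB]
    rw [sumOff, hdec, ENNReal.tsum_add, sum_eq_tsum_indicator, sumOff]
  rw [e1, split (Finset.range n) G, split G (Finset.range n), Finset.union_comm]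
  gcongr ?_ + _
  have hcard : (G \ Finset.range n).card ≤ (Finset.range n \ G).card :=
    Finset.card_sdiff_le_card_sdiff_iff.2 (by simpa using hG)
  calc ∑ k ∈ G \ Finset.range n, x k ≤ (G \ Finset.range n).card • x n :=
        Finset.sum_le_card_nsmul _ _ _ fun k hk => hx (by simpa using (Finset.mem_sdiff.1 hk).2)
    _ ≤ (Finset.range n \ G).card • x n := by gcongr
    _ ≤ ∑ k ∈ Finset.range n \ G, x k :=
        Finset.card_nsmul_le_sum _ _ _ fun k hk =>
          hx (by simpa using (Finset.mem_range.1 (Finset.mem_sdiff.1 hk).1).le)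

theorem tsum_nat_add_le_sumOff_of_enumeration {φ : ℕ → ℝ≥0∞} {σ : ℕ → ℕ}
    (hσ : Function.Injective σ) (hanti : Antitone (φ ∘ σ))
    (h0 : ∀ k, k ∉ Set.range σ → φ k = 0) {n : ℕ} {F : Finset ℕ} (hF : F.card ≤ n) :
    ∑' i, φ (σ (n + i)) ≤ sumOff φ F := by
  classical
  have := tsum_nat_add_le_sumOff hanti (n := n) (G := F.preimage σ hσ.injOn)
    ((by rw [Finset.card_preimage]; exact Finset.card_filter_le _ _ : _ ≤ F.card).trans hF)
  refine this.trans (le_of_eq ?_)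
  rw [sumOff, sumOff, tsum_eq_tsum_comp_of_injective (φ := (Fᶜ : Set ℕ).indicator φ) hσ]
  · refine tsum_congr fun i => ?_
    simp [Set.indicator]
  · intro k hk
    simp [Set.indicator, h0 k hk]

theorem sumOff_eq_top_of_infinite {φ : ℕ → ℝ≥0∞} {ε : ℝ≥0∞} (hε : 0 < ε)
    (h : {k | ε ≤ φ k}.Infinite) (F : Finset ℕ) : sumOff φ F = ∞ := by
  by_contra hne
  have hfin := ENNReal.finite_const_le_of_tsum_ne_top hne hε.ne'
  refine h ((hfin.union F.finite_toSet).subset fun k hk => ?_)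
  by_cases hkF : k ∈ F
  · exact Or.inr hkF
  · left
    simpa [Set.indicator, hkF] using hk

/-! ### Rearrangements on `ℕ` and the combinatorial form of tail majorization -/

theorem rearrangement_floor (f : ℕ → ℝ) {t : ℝ} (ht : 0 ≤ t) :
    rearrangement Measure.count f t = rearrangement Measure.count f (⌊t⌋₊ : ℝ) := by
  unfold rearrangement
  congr 1
  ext s
  simp only [Set.mem_ofPred_eq, ENNReal.ofReal_natCast]
  set A := {x | s < ‖f x‖ₑ}
  by_cases hA : A.Finite
  · rw [Measure.count_apply_finite _ hA, ← ENNReal.ofReal_natCast,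
      ENNReal.ofReal_le_ofReal_iff ht, ENNReal.ofReal_natCast, Nat.cast_le, Nat.le_floor_iff ht]
  · rw [Measure.count_apply_infinite hA]
    simp

/-- Indexing starts at `0`: at most `n` terms exceed the one at `σ n`, whereas `n + 1` terms exceed
any smaller level. -/
theorem rearrangement_nat_of_enumeration {f : ℕ → ℝ} {σ : ℕ → ℕ}
    (hσ : Function.Injective σ) (hanti : Antitone ((fun k => ‖f k‖ₑ) ∘ σ))
    (h0 : ∀ k, k ∉ Set.range σ → ‖f k‖ₑ = 0) (n : ℕ) :
    rearrangement Measure.count f n = ‖f (σ n)‖ₑ := by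
  unfold rearrangement
  refine le_antisymm (sInf_le ?_) (le_sInf fun s hs => ?_)
  · have hsub : {x | ‖f (σ n)‖ₑ < ‖f x‖ₑ} ⊆ ((Finset.range n).image σ : Finset ℕ) := by
      intro k hk
      have hk' : k ∈ Set.range σ := by
        by_contra hn
        have := h0 k hn
        simp [this] at hk
      obtain ⟨i, rfl⟩ := hk'
      simp only [Finset.coe_image, Finset.coe_range]
      refine ⟨i, ?_, rfl⟩
      by_contra hi
      exact absurd (hanti (not_lt.1 hi)) (not_le.2 hk)
    refine (measure_mono hsub).trans ?_
    rw [Measure.count_apply_finset, ENNReal.ofReal_natCast]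
    exact_mod_cast Finset.card_image_le.trans (by simp)
  · by_contra hlt
    rw [not_le] at hlt
    have hsub : (((Finset.range (n + 1)).image σ : Finset ℕ) : Set ℕ) ⊆ {x | s < ‖f x‖ₑ} := by
      intro k hk
      simp only [Finset.coe_image, Finset.coe_range] at hk
      obtain ⟨i, hi, rfl⟩ := hk
      exact hlt.trans_le (hanti (Nat.lt_succ_iff.1 hi))
    have := (measure_mono hsub).trans hs
    rw [Measure.count_apply_finset, ENNReal.ofReal_natCast, Nat.cast_le,
      Finset.card_image_of_injective _ hσ, Finset.card_range] at this
    omega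

theorem le_rearrangement_of_infinite {f : ℕ → ℝ} {ε : ℝ≥0∞} (h : {k | ε ≤ ‖f k‖ₑ}.Infinite)
    (t : ℝ) : ε ≤ rearrangement Measure.count f t := by
  refine le_sInf fun s hs => ?_
  by_contra hlt
  rw [not_le] at hlt
  have hinf : {x | s < ‖f x‖ₑ}.Infinite := h.mono fun k hk => hlt.trans_le hk
  simp only [Set.mem_ofPred_eq] at hs
  rw [Measure.count_apply_infinite hinf] at hs
  simp at hs

theorem tsum_rearrangement_le_sumOff (f : ℕ → ℝ) {n : ℕ} {F : Finset ℕ} (hF : F.card ≤ n) :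
    ∑' i : ℕ, rearrangement Measure.count f ((n + i : ℕ) : ℝ) ≤ sumOff (fun k => ‖f k‖ₑ) F := by
  by_cases h : ∀ ε > 0, {k | ε ≤ ‖f k‖ₑ}.Finite
  · obtain ⟨σ, hσ, hanti, h0⟩ := exists_decreasing_enumeration _ h
    simp_rw [rearrangement_nat_of_enumeration hσ hanti h0]
    exact tsum_nat_add_le_sumOff_of_enumeration (φ := fun k => ‖f k‖ₑ) hσ hanti h0 hF
  · push Not at h
    obtain ⟨ε, hε, hinf⟩ := h
    rw [sumOff_eq_top_of_infinite hε hinf]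
    exact le_top

theorem exists_sumOff_le_tsum_rearrangement (f : ℕ → ℝ) (n : ℕ) :
    ∃ F : Finset ℕ, F.card ≤ n ∧ sumOff (fun k => ‖f k‖ₑ) F ≤
      ∑' i : ℕ, rearrangement Measure.count f ((n + i : ℕ) : ℝ) := by
  by_cases h : ∀ ε > 0, {k | ε ≤ ‖f k‖ₑ}.Finite
  · obtain ⟨σ, hσ, hanti, h0⟩ := exists_decreasing_enumeration _ h
    refine ⟨(Finset.range n).image σ, Finset.card_image_le.trans (by simp), ?_⟩
    simp_rw [rearrangement_nat_of_enumeration hσ hanti h0]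
    rw [sumOff_image_range hσ h0]
  · push Not at h
    obtain ⟨ε, hε, hinf⟩ := h
    refine ⟨∅, by simp, le_top.trans (top_le_iff.2 ?_).ge⟩
    refine top_le_iff.1 ?_
    calc (∞ : ℝ≥0∞) = ∑' _ : ℕ, ε := (ENNReal.tsum_const_eq_top_of_ne_zero hε.ne').symm
      _ ≤ _ := ENNReal.tsum_le_tsum fun i => le_rearrangement_of_infinite hinf _

theorem setLIntegral_Ioi_floor (h : ℕ → ℝ≥0∞) {n : ℕ} {t : ℝ} (h1 : (n : ℝ) ≤ t)
    (h2 : t ≤ n + 1) :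
    ∫⁻ s in Set.Ioi t, h ⌊s⌋₊ = ENNReal.ofReal (n + 1 - t) * h n + ∑' i, h (n + 1 + i) := by
  have hIco : ∀ (m : ℕ) (a : ℝ), (m : ℝ) ≤ a → ∫⁻ s in Set.Ico a (m + 1), h ⌊s⌋₊ =
      ENNReal.ofReal (m + 1 - a) * h m := by
    intro m a ha
    rw [setLIntegral_congr_fun measurableSet_Ico (g := fun _ => h m)]
    · rw [setLIntegral_const, Real.volume_Ico, mul_comm]
    · intro s hs
      have : ⌊s⌋₊ = m := (Nat.floor_eq_iff (le_trans (by positivity) (ha.trans hs.1))).2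
        ⟨ha.trans hs.1, hs.2⟩
      simp [this]
  have htail : ∀ m : ℕ, ∫⁻ s in Set.Ici (m : ℝ), h ⌊s⌋₊ = ∑' i, h (m + i) := by
    intro m
    have hU : Set.Ici (m : ℝ) = ⋃ i : ℕ, Set.Ico ((m + i : ℕ) : ℝ) ((m + i : ℕ) + 1) := by
      ext s
      simp only [Set.mem_Ici, Set.mem_iUnion, Set.mem_Ico]
      constructor
      · intro hs
        have hs0 : 0 ≤ s := le_trans (by positivity) hs
        refine ⟨⌊s⌋₊ - m, ?_⟩
        rw [Nat.add_sub_cancel' (Nat.le_floor hs)]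
        exact ⟨Nat.floor_le hs0, Nat.lt_floor_add_one s⟩
      · rintro ⟨i, hi, -⟩
        push_cast at hi
        have : (0 : ℝ) ≤ i := by positivity
        linarith
    rw [hU, lintegral_iUnion (fun _ => measurableSet_Ico)]
    · refine tsum_congr fun i => ?_
      rw [hIco _ _ le_rfl]
      simp
    · intro i j hij
      refine Set.disjoint_left.2 fun s hi hj => hij ?_
      have hs0 : 0 ≤ s := le_trans (by positivity) hi.1
      have e1 := (Nat.floor_eq_iff hs0).2 ⟨hi.1, hi.2⟩
      have e2 := (Nat.floor_eq_iff hs0).2 ⟨hj.1, hj.2⟩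
      omega
  rw [setLIntegral_congr Ioi_ae_eq_Ici, ← Set.Ico_union_Ici_eq_Ici h2,
    lintegral_union measurableSet_Ici, hIco n t h1]
  · have := htail (n + 1)
    push_cast at this
    rw [this]
  · exact Set.disjoint_left.2 fun s hs hs' => not_lt.2 hs' hs.2

theorem setLIntegral_Ioi_rearrangement (f : ℕ → ℝ) {n : ℕ} {t : ℝ} (h1 : (n : ℝ) ≤ t)
    (h2 : t ≤ n + 1) :
    ∫⁻ s in Set.Ioi t, rearrangement Measure.count f s =
      ENNReal.ofReal (n + 1 - t) * rearrangement Measure.count f n +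
        ∑' i : ℕ, rearrangement Measure.count f ((n + 1 + i : ℕ) : ℝ) := by
  rw [← setLIntegral_Ioi_floor (fun m => rearrangement Measure.count f m) h1 h2]
  refine setLIntegral_congr_fun measurableSet_Ioi fun s hs => ?_
  exact rearrangement_floor f (le_trans (by positivity) (h1.trans (le_of_lt hs)))

/-- The rearrangement is a step function, so its tail integral is affine between consecutive
integers. Letting `t` decrease to `n` gives the integer inequalities, including `n = 0`, which the
condition `0 < t` excludes; conversely, an intermediate `t` is a convex combination of two integers.
-/
theorem tailMajorized_count_iff (g f : ℕ → ℝ) :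
    TailMajorized Measure.count g f ↔ ∀ n : ℕ,
      ∑' i : ℕ, rearrangement Measure.count g ((n + i : ℕ) : ℝ) ≤
        ∑' i : ℕ, rearrangement Measure.count f ((n + i : ℕ) : ℝ) := by
  have hsucc : ∀ (f : ℕ → ℝ) (n : ℕ), ∑' i : ℕ, rearrangement Measure.count f ((n + i : ℕ) : ℝ) =
      rearrangement Measure.count f n +
        ∑' i : ℕ, rearrangement Measure.count f ((n + 1 + i : ℕ) : ℝ) := by
    intro f n
    rw [tsum_eq_zero_add' ENNReal.summable]
    congr 1
    refine tsum_congr fun i => ?_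
    rw [show n + (i + 1) = n + 1 + i by ring]
  constructor
  · intro h n
    rw [hsucc g, hsucc f]
    have hcont : Tendsto (fun t : ℝ => ENNReal.ofReal (n + 1 - t) * rearrangement Measure.count g n +
        ∑' i : ℕ, rearrangement Measure.count g ((n + 1 + i : ℕ) : ℝ)) (𝓝[>] (n : ℝ))
        (𝓝 (1 * rearrangement Measure.count g n +
          ∑' i : ℕ, rearrangement Measure.count g ((n + 1 + i : ℕ) : ℝ))) := by
      refine (ENNReal.Tendsto.mul_const ?_ (Or.inl one_ne_zero)).add_const _
      have : Tendsto (fun t : ℝ => ENNReal.ofReal (n + 1 - t)) (𝓝[>] (n : ℝ))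
          (𝓝 (ENNReal.ofReal (n + 1 - n))) :=
        (ENNReal.continuous_ofReal.comp (continuous_const.sub continuous_id)).continuousWithinAt
      simpa using this
    rw [one_mul] at hcont
    refine le_of_tendsto hcont ?_
    filter_upwards [Ioo_mem_nhdsGT (show (n : ℝ) < n + 1 by linarith)] with t ht
    have h3 := h t (lt_of_le_of_lt (by positivity) ht.1)
    rw [setLIntegral_Ioi_rearrangement g ht.1.le ht.2.le,
      setLIntegral_Ioi_rearrangement f ht.1.le ht.2.le] at h3
    refine h3.trans ?_
    gcongr
    refine mul_le_of_le_one_left zero_le (ENNReal.ofReal_le_one.2 ?_)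
    linarith [ht.1]
  · intro h t ht
    have h1 : ((⌊t⌋₊ : ℕ) : ℝ) ≤ t := Nat.floor_le ht.le
    have h2 : t ≤ (⌊t⌋₊ : ℕ) + 1 := (Nat.lt_floor_add_one t).le
    generalize ⌊t⌋₊ = n at h1 h2
    rw [setLIntegral_Ioi_rearrangement g h1 h2, setLIntegral_Ioi_rearrangement f h1 h2]
    have key : ∀ a A : ℝ≥0∞, ENNReal.ofReal (n + 1 - t) * a + A =
        ENNReal.ofReal (n + 1 - t) * (a + A) + ENNReal.ofReal (t - n) * A := by
      intro a A
      have : ENNReal.ofReal (n + 1 - t) + ENNReal.ofReal (t - n) = 1 := by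
        rw [← ENNReal.ofReal_add (by linarith) (by linarith)]
        simp
      rw [mul_add, add_assoc, ← add_mul, this, one_mul]
    rw [key (rearrangement _ g n), key (rearrangement _ f n), ← hsucc, ← hsucc]
    exact add_le_add (mul_le_mul_right (h n) _) (mul_le_mul_right (h (n + 1)) _)

theorem tailMajorized_count_iff_tailDominated (g f : ℕ → ℝ) :
    TailMajorized Measure.count g f ↔ TailDominated (fun k => ‖g k‖ₑ) (fun k => ‖f k‖ₑ) := by
  rw [tailMajorized_count_iff]
  constructor
  · intro h F
    obtain ⟨F', hF', hle⟩ := exists_sumOff_le_tsum_rearrangement g F.card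
    exact ⟨F', hF', hle.trans ((h _).trans (tsum_rearrangement_le_sumOff f le_rfl))⟩
  · intro h n
    obtain ⟨F, hF, hle⟩ := exists_sumOff_le_tsum_rearrangement f n
    obtain ⟨F', hF', hle'⟩ := h F
    exact (tsum_rearrangement_le_sumOff g (hF'.trans hF)).trans (hle'.trans hle)

variable {𝕜 : Type*} [RCLike 𝕜]

theorem tailMajorizedPow_iff {q : ℝ} (hq : 0 ≤ q) (v u : ℕ → 𝕜) :
    TailMajorizedPow q v u ↔
      TailDominated (fun k => ‖v k‖ₑ ^ q) (fun k => ‖u k‖ₑ ^ q) := by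
  have key : ∀ w : ℕ → 𝕜, (fun k => ‖‖w k‖ ^ q‖ₑ) = fun k => ‖w k‖ₑ ^ q := by
    intro w
    funext k
    rw [Real.enorm_of_nonneg (by positivity), ← ENNReal.ofReal_rpow_of_nonneg (norm_nonneg _) hq,
      ofReal_norm]
  rw [TailMajorizedPow, tailMajorized_count_iff_tailDominated, key, key]

/-! ### Quasi-Banach sequence spaces: majorants and automatic boundedness -/

open Classical in
/-- The quasi-norm of a sequence space, extended by `0` to all sequences. -/
noncomputable def NormedSeqSpace.nm (E : NormedSeqSpace 𝕜) (x : ℕ → 𝕜) : ℝ :=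
  if h : x ∈ E.carrier then E.qnorm ⟨x, h⟩ else 0

theorem NormedSeqSpace.nm_of_mem (E : NormedSeqSpace 𝕜) {x : ℕ → 𝕜} (h : x ∈ E.carrier) :
    E.nm x = E.qnorm ⟨x, h⟩ := dif_pos h

namespace NormedSeqSpace.IsQuasiBanach

variable {E : NormedSeqSpace 𝕜}

theorem nm_nonneg (hE : E.IsQuasiBanach) (x : ℕ → 𝕜) : 0 ≤ E.nm x := by
  unfold NormedSeqSpace.nm
  split_ifs with h
  · exact hE.nonneg _
  · exact le_rfl

theorem eq_zero_of_nm_eq_zero (hE : E.IsQuasiBanach) {x : ℕ → 𝕜} (hx : x ∈ E.carrier)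
    (h : E.nm x = 0) : x = 0 := by
  rw [E.nm_of_mem hx, hE.eq_zero_iff] at h
  exact congrArg Subtype.val h

theorem nm_zero (hE : E.IsQuasiBanach) : E.nm 0 = 0 := by
  rw [E.nm_of_mem E.carrier.zero_mem, hE.eq_zero_iff]
  rfl

theorem nm_smul (hE : E.IsQuasiBanach) (a : 𝕜) {x : ℕ → 𝕜} (hx : x ∈ E.carrier) :
    E.nm (a • x) = ‖a‖ * E.nm x := by
  rw [E.nm_of_mem (E.carrier.smul_mem a hx), E.nm_of_mem hx, ← hE.smul]
  rfl

theorem exists_add_const (hE : E.IsQuasiBanach) : ∃ K : ℝ, 1 ≤ K ∧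
    ∀ x y, x ∈ E.carrier → y ∈ E.carrier → E.nm (x + y) ≤ K * (E.nm x + E.nm y) := by
  obtain ⟨C, hC⟩ := hE.add_le
  refine ⟨max C 1, le_max_right _ _, fun x y hx hy => ?_⟩
  have h1 : E.nm (x + y) ≤ C * (E.nm x + E.nm y) := by
    rw [E.nm_of_mem hx, E.nm_of_mem hy, E.nm_of_mem (E.carrier.add_mem hx hy)]
    exact hC ⟨x, hx⟩ ⟨y, hy⟩
  exact h1.trans (mul_le_mul_of_nonneg_right (le_max_left _ _)
    (add_nonneg (hE.nm_nonneg _) (hE.nm_nonneg _)))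

theorem mem_and_nm_le (hE : E.IsQuasiBanach) {x y : ℕ → 𝕜} (hy : y ∈ E.carrier)
    (h : ∀ k, ‖x k‖ ≤ ‖y k‖) : x ∈ E.carrier ∧ E.nm x ≤ E.nm y := by
  obtain ⟨hx, hle⟩ := hE.solid ⟨y, hy⟩ x h
  refine ⟨hx, ?_⟩
  rwa [E.nm_of_mem hx, E.nm_of_mem hy]

/-- By solidity, `x k` times the unit vector at `k` has quasi-norm at most that of `x`. This is what
turns convergence in `E` into pointwise convergence. -/
theorem exists_norm_apply_le (hE : E.IsQuasiBanach) (k : ℕ) :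
    ∃ C : ℝ, ∀ x ∈ E.carrier, ‖x k‖ ≤ C * E.nm x := by
  classical
  by_cases hz : ∀ x ∈ E.carrier, x k = 0
  · exact ⟨0, fun x hx => by simp [hz x hx]⟩
  push Not at hz
  obtain ⟨z, hz, hzk⟩ := hz
  have hsingle : ∀ x ∈ E.carrier, x k • Pi.single k (1 : 𝕜) ∈ E.carrier ∧
      E.nm (x k • Pi.single k (1 : 𝕜)) ≤ E.nm x := by
    intro x hx
    refine hE.mem_and_nm_le hx fun i => ?_
    by_cases hi : i = k
    · subst hi; simp
    · simp [hi]
  have he : (Pi.single k (1 : 𝕜) : ℕ → 𝕜) ∈ E.carrier := by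
    have := E.carrier.smul_mem (z k)⁻¹ (hsingle z hz).1
    rwa [smul_smul, inv_mul_cancel₀ hzk, one_smul] at this
  have hpos : 0 < E.nm (Pi.single k (1 : 𝕜)) := by
    refine lt_of_le_of_ne (hE.nm_nonneg _) fun h => ?_
    have := congrFun (hE.eq_zero_of_nm_eq_zero he h.symm) k
    simp at this
  refine ⟨(E.nm (Pi.single k (1 : 𝕜)))⁻¹, fun x hx => ?_⟩
  have := (hsingle x hx).2
  rw [hE.nm_smul _ he] at this
  rwa [inv_mul_eq_div, le_div_iff₀ hpos]

/-- Rapidly decreasing sequences of elements of `E` have a common majorant in `E`. -/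
theorem exists_majorant (hE : E.IsQuasiBanach) {K : ℝ} (hK1 : 1 ≤ K)
    (hK : ∀ x y, x ∈ E.carrier → y ∈ E.carrier → E.nm (x + y) ≤ K * (E.nm x + E.nm y))
    {A : ℝ} {x : ℕ → ℕ → 𝕜} (hx : ∀ n, x n ∈ E.carrier)
    (hxA : ∀ n, E.nm (x n) ≤ A * ((2 * K) ^ (n + 1))⁻¹) :
    ∃ y ∈ E.carrier, E.nm y ≤ K * A ∧ ∀ n k, ‖x n k‖ ≤ ‖y k‖ := by
  have hK0 : 0 < 2 * K := by linarith
  have hA0 : 0 ≤ A := by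
    have := (hE.nm_nonneg _).trans (hxA 0)
    exact nonneg_of_mul_nonneg_left this (by positivity)
  -- Moduli make the partial sums pointwise increasing, so their limit dominates each summand.
  let a : ℕ → ℕ → 𝕜 := fun n k => ((‖x n k‖ : ℝ) : 𝕜)
  have ha : ∀ n, a n ∈ E.carrier ∧ E.nm (a n) ≤ E.nm (x n) := fun n =>
    hE.mem_and_nm_le (hx n) fun k => by simp [a]
  let s : ℕ → ℕ → 𝕜 := fun N => ∑ n ∈ Finset.range N, a n
  have hs : ∀ N, s N ∈ E.carrier := fun N => E.carrier.sum_mem fun n _ => (ha n).1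
  -- The ratio `2 * K` absorbs the quasi-triangle constant: `K` times two equal bounds at level `N +
  -- 1` is exactly the bound at level `N`.
  have hblock : ∀ M N, E.nm (∑ n ∈ Finset.Ico N (N + M), a n) ≤ A * ((2 * K) ^ N)⁻¹ := by
    intro M
    induction M with
    | zero =>
      intro N
      simp only [add_zero, Finset.Ico_self, Finset.sum_empty, hE.nm_zero]
      positivity
    | succ M ih =>
      intro N
      rw [Finset.sum_eq_sum_Ico_succ_bot (by omega), show N + (M + 1) = N + 1 + M by ring]
      refine (hK _ _ (ha N).1 (E.carrier.sum_mem fun n _ => (ha n).1)).trans ?_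
      have h1 := (ha N).2.trans (hxA N)
      have h2 := ih (N + 1)
      calc K * _ ≤ K * (A * ((2 * K) ^ (N + 1))⁻¹ + A * ((2 * K) ^ (N + 1))⁻¹) := by gcongr
        _ = A * ((2 * K) ^ N)⁻¹ := by
          rw [pow_succ]
          field_simp
          ring
  have hdiff : ∀ N M, N ≤ M → E.nm (s M - s N) ≤ A * ((2 * K) ^ N)⁻¹ := by
    intro N M hNM
    have := hblock (M - N) N
    rwa [Nat.add_sub_cancel' hNM, Finset.sum_Ico_eq_sub _ hNM] at this
  have hneg : ∀ z ∈ E.carrier, E.nm (-z) = E.nm z := by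
    intro z hz
    have := hE.nm_smul (-1) hz
    simpa using this
  have hlim : Tendsto (fun N : ℕ => A * ((2 * K) ^ N)⁻¹) atTop (𝓝 0) := by
    have h1 : Tendsto (fun N : ℕ => ((2 * K)⁻¹) ^ N) atTop (𝓝 0) :=
      tendsto_pow_atTop_nhds_zero_of_lt_one (by positivity) (inv_lt_one_of_one_lt₀ (by linarith))
    simp_rw [← inv_pow]
    simpa only [mul_zero] using h1.const_mul A
  obtain ⟨y, hy⟩ := hE.complete (fun N => ⟨s N, hs N⟩) (by
    intro ε hε
    obtain ⟨N, hN⟩ := (hlim.eventually (gt_mem_nhds hε)).exists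
    have hanti : ∀ m, N ≤ m → A * ((2 * K) ^ m)⁻¹ ≤ A * ((2 * K) ^ N)⁻¹ := by
      intro m hm
      gcongr
      linarith
    refine ⟨N, fun m hm n hn => ?_⟩
    have e : ∀ m n, E.qnorm (⟨s m, hs m⟩ - ⟨s n, hs n⟩) = E.nm (s m - s n) := fun m n =>
      (E.nm_of_mem (E.carrier.sub_mem (hs m) (hs n))).symm
    rw [e]
    rcases le_total n m with h | h
    · exact ((hdiff n m h).trans (hanti n hn)).trans_lt hN
    · rw [← neg_sub, hneg _ (E.carrier.sub_mem (hs n) (hs m))]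
      exact ((hdiff m n h).trans (hanti m hm)).trans_lt hN)
  have hy' : Tendsto (fun N => E.nm (s N - y)) atTop (𝓝 0) := by
    refine hy.congr fun N => ?_
    exact (E.nm_of_mem (E.carrier.sub_mem (hs N) y.2)).symm
  have hpt : ∀ k, Tendsto (fun N => s N k) atTop (𝓝 ((y : ℕ → 𝕜) k)) := by
    intro k
    obtain ⟨C, hC⟩ := hE.exists_norm_apply_le k
    rw [tendsto_iff_norm_sub_tendsto_zero]
    refine squeeze_zero (fun _ => norm_nonneg _) (fun N => ?_) (by simpa using hy'.const_mul C)
    exact hC _ (E.carrier.sub_mem (hs N) y.2)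
  refine ⟨y, y.2, ?_, fun n k => ?_⟩
  -- A quasi-norm need not be continuous; the quasi-triangle inequality bounds the limit at the cost
  -- of a factor `K`.
  · have h1 : ∀ N, E.nm (y : ℕ → 𝕜) ≤ K * (E.nm (s N - y) + A) := by
      intro N
      have h2 := hK (y - s N) (s N) (E.carrier.sub_mem y.2 (hs N)) (hs N)
      rw [sub_add_cancel, ← neg_sub, hneg _ (E.carrier.sub_mem (hs N) y.2)] at h2
      have h3 : E.nm (s N) ≤ A := by simpa [s] using hdiff 0 N (Nat.zero_le _)
      refine h2.trans ?_
      gcongr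
    refine ge_of_tendsto' (by simpa using (hy'.add_const A).const_mul K) h1
  · refine ge_of_tendsto (hpt k).norm ?_
    filter_upwards [eventually_gt_atTop n] with N hN
    have e : s N k = ((∑ n ∈ Finset.range N, ‖x n k‖ : ℝ) : 𝕜) := by
      simp [s, a, Finset.sum_apply]
    rw [e, RCLike.norm_ofReal, abs_of_nonneg (Finset.sum_nonneg fun _ _ => norm_nonneg _)]
    exact Finset.single_le_sum (f := fun n => ‖x n k‖) (fun _ _ => norm_nonneg _)
      (Finset.mem_range.2 hN)

/-- A homogeneous operator that respects pointwise domination and preserves `E` is bounded. -/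
theorem exists_bound_of_monotone (hE : E.IsQuasiBanach) (Φ : (ℕ → 𝕜) → ℕ → 𝕜)
    (hsmul : ∀ (a : 𝕜) x, Φ (a • x) = a • Φ x)
    (hmono : ∀ x y, (∀ k, ‖x k‖ ≤ ‖y k‖) → ∀ k, ‖Φ x k‖ ≤ ‖Φ y k‖)
    (hmem : ∀ x ∈ E.carrier, Φ x ∈ E.carrier) :
    ∃ C : ℝ, 0 < C ∧ ∀ x ∈ E.carrier, E.nm (Φ x) ≤ C * E.nm x := by
  obtain ⟨K, hK1, hK⟩ := hE.exists_add_const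
  by_contra! hcon
  have hK0 : 0 < 2 * K := by linarith
  -- Counterexamples are rescaled to be geometrically small while their images exceed `n`; the image
  -- of a common majorant then exceeds every `n`.
  have hx : ∀ n : ℕ, ∃ x ∈ E.carrier, E.nm x ≤ 1 * ((2 * K) ^ (n + 1))⁻¹ ∧ (n : ℝ) < E.nm (Φ x) := by
    intro n
    obtain ⟨x, hx, hlt⟩ := hcon ((n + 1) * (2 * K) ^ (n + 1)) (by positivity)
    have hpos : 0 < E.nm x := by
      refine lt_of_le_of_ne (hE.nm_nonneg _) fun h => ?_
      have hx0 := hE.eq_zero_of_nm_eq_zero hx h.symm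
      have : Φ x = 0 := by
        have := hsmul 0 x
        rw [zero_smul, zero_smul, ← hx0] at this
        exact this.trans hx0
      rw [this, ← h, hE.nm_zero] at hlt
      simp at hlt
    have hn : ‖((((2 * K) ^ (n + 1))⁻¹ * (E.nm x)⁻¹ : ℝ) : 𝕜)‖ =
        ((2 * K) ^ (n + 1))⁻¹ * (E.nm x)⁻¹ := by
      rw [RCLike.norm_ofReal, abs_of_nonneg (by positivity)]
    refine ⟨((((2 * K) ^ (n + 1))⁻¹ * (E.nm x)⁻¹ : ℝ) : 𝕜) • x, E.carrier.smul_mem _ hx, ?_, ?_⟩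
    · rw [hE.nm_smul _ hx, hn, mul_assoc, inv_mul_cancel₀ hpos.ne', mul_one, one_mul]
    · rw [hsmul, hE.nm_smul _ (hmem x hx), hn, mul_assoc, ← div_eq_inv_mul, ← div_eq_inv_mul,
        lt_div_iff₀ (by positivity), lt_div_iff₀ hpos]
      refine lt_of_le_of_lt ?_ hlt
      gcongr
      linarith
  choose x hxE hxn hxΦ using hx
  obtain ⟨y, hy, -, hdom⟩ := hE.exists_majorant hK1 hK hxE hxn
  obtain ⟨n, hn⟩ := exists_nat_gt (E.nm (Φ y))
  have := (hE.mem_and_nm_le (hmem y hy) (hmono (x n) y (hdom n))).2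
  linarith [hxΦ n]

end NormedSeqSpace.IsQuasiBanach

/-! ### The spaces `ℓ^r` and nonnegative matrices acting on them -/

theorem mem_ellp_iff {r : ℝ} (hr : 0 < r) (x : ℕ → 𝕜) :
    x ∈ (ellp 𝕜 (ENNReal.ofReal r)).carrier ↔ ∑' k, ‖x k‖ₑ ^ r ≠ ∞ := by
  have hr' : (ENNReal.ofReal r).toReal = r := ENNReal.toReal_ofReal hr.le
  have e : ∀ k, ‖x k‖ₑ ^ r = ENNReal.ofReal (‖x k‖ ^ r) := fun k => by
    rw [← ENNReal.ofReal_rpow_of_nonneg (norm_nonneg _) hr.le, ofReal_norm]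
  change Memℓp x _ ↔ _
  rw [memℓp_gen_iff (by rwa [hr'])]
  simp_rw [hr', e]
  constructor
  · exact fun h => h.tsum_ofReal_ne_top
  · intro h
    refine (ENNReal.summable_toReal h).congr fun k => ?_
    rw [ENNReal.toReal_ofReal (by positivity)]

theorem qnorm_ellp_nonneg {p : ℝ≥0∞} (x : (ellp 𝕜 p).carrier) : 0 ≤ (ellp 𝕜 p).qnorm x :=
  lp.norm_nonneg' (⟨x.1, x.2⟩ : lp (fun _ : ℕ => 𝕜) p)

theorem ofReal_qnorm_ellp_rpow {r : ℝ} (hr : 0 < r) (x : (ellp 𝕜 (ENNReal.ofReal r)).carrier) :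
    ENNReal.ofReal ((ellp 𝕜 (ENNReal.ofReal r)).qnorm x) ^ r = ∑' k, ‖(x : ℕ → 𝕜) k‖ₑ ^ r := by
  have hr' : (ENNReal.ofReal r).toReal = r := ENNReal.toReal_ofReal hr.le
  have e : ∀ k, ‖(x : ℕ → 𝕜) k‖ₑ ^ r = ENNReal.ofReal (‖(x : ℕ → 𝕜) k‖ ^ r) := fun k => by
    rw [← ENNReal.ofReal_rpow_of_nonneg (norm_nonneg _) hr.le, ofReal_norm]
  have hsum := (memℓp_gen_iff (by rwa [hr'])).1 x.2
  have h := lp.norm_rpow_eq_tsum (p := ENNReal.ofReal r) (by rwa [hr'])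
    (⟨x.1, x.2⟩ : lp (fun _ : ℕ => 𝕜) (ENNReal.ofReal r))
  rw [hr'] at h hsum
  simp_rw [e]
  rw [← ENNReal.ofReal_tsum_of_nonneg (fun _ => by positivity) hsum,
    ENNReal.ofReal_rpow_of_nonneg (qnorm_ellp_nonneg x) hr.le]
  exact congrArg ENNReal.ofReal h

theorem restrictsBounded_ellp_iff {r : ℝ} (hr : 0 < r) {V : Submodule 𝕜 (ℕ → 𝕜)}
    (T : V →ₗ[𝕜] V) :
    RestrictsBounded T (ellp 𝕜 (ENNReal.ofReal r)) ↔
      ∃ C : ℝ≥0∞, C ≠ ∞ ∧ ∀ x : V, ∑' k, ‖(x : ℕ → 𝕜) k‖ₑ ^ r ≠ ∞ →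
        ∑' k, ‖(T x : ℕ → 𝕜) k‖ₑ ^ r ≤ C * ∑' k, ‖(x : ℕ → 𝕜) k‖ₑ ^ r := by
  constructor
  · rintro ⟨C, hC⟩
    refine ⟨ENNReal.ofReal C ^ r, by finiteness, fun x hx => ?_⟩
    obtain ⟨hT, hle⟩ := hC x ((mem_ellp_iff hr _).2 hx)
    rw [← ofReal_qnorm_ellp_rpow hr ⟨_, hT⟩,
      ← ofReal_qnorm_ellp_rpow hr ⟨_, (mem_ellp_iff hr _).2 hx⟩, ← ENNReal.mul_rpow_of_nonneg _ _ hr.le]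
    gcongr
    refine (ENNReal.ofReal_le_ofReal hle).trans (le_of_eq ?_)
    exact ENNReal.ofReal_mul' (qnorm_ellp_nonneg _)
  · rintro ⟨C, hCtop, hC⟩
    refine ⟨(C ^ r⁻¹).toReal, fun x hx => ?_⟩
    have hx' := (mem_ellp_iff hr _).1 hx
    have hle := hC x hx'
    have hT := (mem_ellp_iff hr _).2 (ne_top_of_le_ne_top (by finiteness) hle)
    refine ⟨hT, ?_⟩
    rw [← ofReal_qnorm_ellp_rpow hr ⟨_, hT⟩, ← ofReal_qnorm_ellp_rpow hr ⟨_, hx⟩] at hle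
    have h2 := ENNReal.rpow_le_rpow hle (inv_nonneg.2 hr.le)
    rw [ENNReal.mul_rpow_of_nonneg _ _ (inv_nonneg.2 hr.le), ENNReal.rpow_rpow_inv hr.ne',
      ENNReal.rpow_rpow_inv hr.ne'] at h2
    have h3 := ENNReal.toReal_mono (by finiteness) h2
    rw [ENNReal.toReal_mul] at h3
    rwa [ENNReal.toReal_ofReal (qnorm_ellp_nonneg _), ENNReal.toReal_ofReal (qnorm_ellp_nonneg _)] at h3

theorem ellp_mono {p q : ℝ≥0∞} (h : p ≤ q) : (ellp 𝕜 p).carrier ≤ (ellp 𝕜 q).carrier :=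
  fun _ hx => Memℓp.of_exponent_ge hx h

/-- The matrix `M`, with nonnegative entries, acts boundedly on `ℓ^r`. -/
def MatrixBounded (r : ℝ) (M : ℕ → ℕ → ℝ) : Prop :=
  ∃ C : ℝ≥0∞, C ≠ ∞ ∧ ∀ x : ℕ → ℝ≥0∞,
    ∑' j, (∑' k, ENNReal.ofReal (M j k) * x k) ^ r ≤ C * ∑' k, x k ^ r

/-- A space with the interpolation property absorbs everything dominated by the image of one of its
elements under a nonnegative matrix which is bounded on both spaces of the couple. -/
theorem IsInterpolationSpace.mem_of_le_matrix {E : NormedSeqSpace 𝕜} (hE : E.IsQuasiBanach)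
    {p q : ℝ} (hp : 0 < p) (hpq : p ≤ q)
    (h : IsInterpolationSpace (ellp 𝕜 (ENNReal.ofReal p)) (ellp 𝕜 (ENNReal.ofReal q)) E)
    {M : ℕ → ℕ → ℝ} (hM : ∀ j k, 0 ≤ M j k) (hMp : MatrixBounded p M) (hMq : MatrixBounded q M)
    {u v : ℕ → 𝕜} (hu : u ∈ E.carrier)
    (hv : ∀ j, ‖v j‖ₑ ≤ ∑' k, ENNReal.ofReal (M j k) * ‖u k‖ₑ) : v ∈ E.carrier := by
  have hq : 0 < q := hp.trans_le hpq
  set V := (ellp 𝕜 (ENNReal.ofReal p)).carrier ⊔ (ellp 𝕜 (ENNReal.ofReal q)).carrier with hV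
  have hVq : V = (ellp 𝕜 (ENNReal.ofReal q)).carrier :=
    sup_eq_right.2 (ellp_mono (ENNReal.ofReal_le_ofReal hpq))
  have hVmem : ∀ x : ℕ → 𝕜, x ∈ V ↔ ∑' k, ‖x k‖ₑ ^ q ≠ ∞ := fun x => by
    rw [hVq, mem_ellp_iff hq]
  have hterm : ∀ (x : ℕ → 𝕜) j k, ‖((M j k : ℝ) : 𝕜) * x k‖ₑ = ENNReal.ofReal (M j k) * ‖x k‖ₑ := by
    intro x j k
    rw [enorm_mul, ← ofReal_norm, RCLike.norm_ofReal, abs_of_nonneg (hM j k)]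
  have hsum : ∀ x ∈ V, ∀ j, Summable fun k => ((M j k : ℝ) : 𝕜) * x k := by
    intro x hx j
    obtain ⟨C, hC, hb⟩ := hMq
    have h1 := hb fun k => ‖x k‖ₑ
    have h2 := ne_top_of_le_ne_top (ENNReal.mul_ne_top hC ((hVmem x).1 hx)) h1
    have h3 := ENNReal.ne_top_of_tsum_ne_top h2 j
    have h4 : ∑' k, ENNReal.ofReal (M j k) * ‖x k‖ₑ ≠ ∞ := fun ht => h3 (by
      simp only [ht, ENNReal.top_rpow_of_pos hq])
    refine Summable.of_norm ((ENNReal.summable_toReal h4).congr fun k => ?_)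
    rw [← hterm, toReal_enorm]
  have hle : ∀ (x : ℕ → 𝕜) j, ‖∑' k, ((M j k : ℝ) : 𝕜) * x k‖ₑ ≤
      ∑' k, ENNReal.ofReal (M j k) * ‖x k‖ₑ := by
    intro x j
    refine enorm_tsum_le_tsum_enorm.trans (le_of_eq ?_)
    exact tsum_congr fun k => hterm x j k
  have hbd : ∀ {r : ℝ}, 0 < r → ∀ C : ℝ≥0∞, (∀ x : ℕ → ℝ≥0∞,
      ∑' j, (∑' k, ENNReal.ofReal (M j k) * x k) ^ r ≤ C * ∑' k, x k ^ r) → ∀ x : ℕ → 𝕜,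
      ∑' j, ‖∑' k, ((M j k : ℝ) : 𝕜) * x k‖ₑ ^ r ≤ C * ∑' k, ‖x k‖ₑ ^ r := by
    intro r hr C hC x
    refine le_trans (ENNReal.tsum_le_tsum fun j => ?_) (hC fun k => ‖x k‖ₑ)
    exact ENNReal.rpow_le_rpow (hle x j) hr.le
  have hmem : ∀ x : V, (fun j => ∑' k, ((M j k : ℝ) : 𝕜) * (x : ℕ → 𝕜) k) ∈ V := by
    intro x
    obtain ⟨C, hC, hb⟩ := hMq
    exact (hVmem _).2 (ne_top_of_le_ne_top (ENNReal.mul_ne_top hC ((hVmem x).1 x.2))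
      (hbd hq C hb x))
  let T : V →ₗ[𝕜] V :=
    { toFun := fun x => ⟨_, hmem x⟩
      map_add' := by
        intro x y
        ext j
        simp only [Submodule.coe_add, Pi.add_apply, mul_add]
        exact (hsum x x.2 j).tsum_add (hsum y y.2 j)
      map_smul' := by
        intro c x
        ext j
        simp only [Submodule.coe_smul, Pi.smul_apply, smul_eq_mul, RingHom.id_apply]
        rw [← tsum_mul_left]
        exact tsum_congr fun k => by ring }
  have hT : ∀ {r : ℝ}, 0 < r → MatrixBounded r M →
      RestrictsBounded T (ellp 𝕜 (ENNReal.ofReal r)) := by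
    rintro r hr ⟨C, hC, hb⟩
    exact (restrictsBounded_ellp_iff hr T).2 ⟨C, hC, fun x _ => hbd hr C hb x⟩
  obtain ⟨C, hC⟩ := h.2.2 T (hT hp hMp) (hT hq hMq)
  -- The operator is applied to `|u|`, so that no cancellation occurs and the image equals the
  -- majorant of `v`.
  let u' : ℕ → 𝕜 := fun k => ((‖u k‖ : ℝ) : 𝕜)
  have hu' : u' ∈ E.carrier := (hE.mem_and_nm_le hu fun k => by simp [u']).1
  obtain ⟨hTu, -⟩ := hC ⟨u', h.2.1 hu'⟩ hu'
  refine (hE.mem_and_nm_le hTu fun j => ?_).1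
  have hsu := hsum u' (h.2.1 hu') j
  have e1 : ∀ k, ((M j k : ℝ) : 𝕜) * u' k = ((M j k * ‖u k‖ : ℝ) : 𝕜) := fun k => by simp [u']
  have hsr : Summable fun k => M j k * ‖u k‖ := by
    refine hsu.norm.congr fun k => ?_
    rw [e1, RCLike.norm_ofReal, abs_of_nonneg (mul_nonneg (hM _ _) (norm_nonneg _))]
  have e2 : ∑' k, ((M j k : ℝ) : 𝕜) * u' k = ((∑' k, M j k * ‖u k‖ : ℝ) : 𝕜) := by
    simp_rw [e1]
    exact (RCLike.ofReal_tsum 𝕜 _).symm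
  change ‖v j‖ ≤ ‖∑' k, ((M j k : ℝ) : 𝕜) * u' k‖
  have hnn : ∀ k, 0 ≤ M j k * ‖u k‖ := fun k => mul_nonneg (hM _ _) (norm_nonneg _)
  rw [e2, RCLike.norm_ofReal, abs_of_nonneg (tsum_nonneg hnn),
    ← ENNReal.ofReal_le_ofReal_iff (tsum_nonneg hnn), ENNReal.ofReal_tsum_of_nonneg hnn hsr, ofReal_norm]
  refine (hv j).trans (le_of_eq (tsum_congr fun k => ?_))
  rw [ENNReal.ofReal_mul (hM j k), ofReal_norm]

theorem matrixBounded_comp {r : ℝ} {σ : ℕ → ℕ} (hσ : Function.Injective σ) :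
    MatrixBounded r fun j k => if k = σ j then 1 else 0 := by
  refine ⟨1, ENNReal.one_ne_top, fun x => ?_⟩
  rw [one_mul]
  refine le_trans (le_of_eq (tsum_congr fun j => ?_))
    (ENNReal.tsum_comp_le_tsum_of_injective hσ fun k => x k ^ r)
  rw [tsum_eq_single (σ j)]
  · simp
  · intro k hk
    simp [hk]

theorem matrixBounded_extend {r : ℝ} (hr : 0 < r) {σ : ℕ → ℕ} (hσ : Function.Injective σ) :
    MatrixBounded r fun j k => if j = σ k then 1 else 0 := by
  refine ⟨1, ENNReal.one_ne_top, fun x => ?_⟩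
  rw [one_mul, tsum_eq_tsum_comp_of_injective hσ]
  · refine le_of_eq (tsum_congr fun j => ?_)
    rw [tsum_eq_single j]
    · simp
    · intro k hk
      simp [hσ.eq_iff, hk.symm]
  · intro k hk
    have : ∀ i, k ≠ σ i := fun i hi => hk ⟨i, hi.symm⟩
    simp [this, hr]

/-- Jensen's inequality; a total weight below one only helps, since the missing mass can be placed
at `0`. -/
theorem rpow_tsum_mul_le_tsum_mul_rpow {r : ℝ} (hr : 1 ≤ r) {w : ℕ → ℝ≥0∞} (hw : ∑' k, w k ≤ 1)
    (z : ℕ → ℝ≥0∞) : (∑' k, w k * z k) ^ r ≤ ∑' k, w k * z k ^ r := by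
  have hr0 : 0 < r := by linarith
  rw [← ENNReal.le_rpow_inv_iff hr0, ENNReal.tsum_eq_iSup_sum]
  refine iSup_le fun s => ?_
  refine (ENNReal.inner_le_weight_mul_Lp_of_nonneg s hr w z).trans ?_
  calc _ ≤ 1 * (∑' k, w k * z k ^ r) ^ r⁻¹ := by
        gcongr
        · refine ENNReal.rpow_le_one ((ENNReal.sum_le_tsum s).trans hw) ?_
          rw [sub_nonneg]
          exact inv_le_one_of_one_le₀ hr
        · exact ENNReal.sum_le_tsum s
    _ = _ := one_mul _

theorem rpow_tsum_le_tsum_rpow {r : ℝ} (hr : 0 < r) (hr1 : r ≤ 1) (z : ℕ → ℝ≥0∞) :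
    (∑' k, z k) ^ r ≤ ∑' k, z k ^ r := by
  rw [← ENNReal.le_rpow_inv_iff hr, ENNReal.tsum_eq_iSup_sum]
  refine iSup_le fun s => ?_
  rw [ENNReal.le_rpow_inv_iff hr]
  refine le_trans ?_ (ENNReal.sum_le_tsum s)
  exact Finset.le_sum_of_subadditive (fun x : ℝ≥0∞ => x ^ r) (by simp [hr])
    (fun a b => ENNReal.rpow_add_le_add_rpow a b hr.le hr1) s z

/-- Schur-type test: bounded rows and weighted columns. -/
theorem matrixBounded_of_one_le {r : ℝ} (hr : 1 ≤ r) {M w c : ℕ → ℕ → ℝ}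
    (hw0 : ∀ j k, 0 ≤ w j k) (hc0 : ∀ j k, 0 ≤ c j k)
    (hM : ∀ j k, M j k = w j k * c j k) (hrow : ∀ j, ∑' k, ENNReal.ofReal (w j k) ≤ 1)
    (hcol : ∀ k, ∑' j, ENNReal.ofReal (w j k * c j k ^ r) ≤ 1) : MatrixBounded r M := by
  refine ⟨1, ENNReal.one_ne_top, fun x => ?_⟩
  have hr0 : 0 ≤ r := by linarith
  calc ∑' j, (∑' k, ENNReal.ofReal (M j k) * x k) ^ r
      ≤ ∑' j, ∑' k, ENNReal.ofReal (w j k * c j k ^ r) * x k ^ r := by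
        refine ENNReal.tsum_le_tsum fun j => ?_
        have := rpow_tsum_mul_le_tsum_mul_rpow hr (hrow j) fun k => ENNReal.ofReal (c j k) * x k
        convert this using 1
        · congr 1
          refine tsum_congr fun k => ?_
          rw [hM, ENNReal.ofReal_mul (hw0 j k), mul_assoc]
        · refine tsum_congr fun k => ?_
          rw [ENNReal.mul_rpow_of_nonneg _ _ hr0, ENNReal.ofReal_mul (hw0 j k),
            ENNReal.ofReal_rpow_of_nonneg (hc0 j k) hr0, mul_assoc]
    _ = ∑' k, (∑' j, ENNReal.ofReal (w j k * c j k ^ r)) * x k ^ r := by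
        rw [ENNReal.tsum_comm]
        exact tsum_congr fun k => ENNReal.tsum_mul_right
    _ ≤ ∑' k, 1 * x k ^ r := ENNReal.tsum_le_tsum fun k => mul_le_mul_left (hcol k) _
    _ = 1 * ∑' k, x k ^ r := ENNReal.tsum_mul_left

/-- For `r ≤ 1` the power `r` is subadditive, so uniformly bounded sums of `r`-th powers down the
columns suffice. -/
theorem matrixBounded_of_le_one {r : ℝ} (hr : 0 < r) (hr1 : r ≤ 1) {M : ℕ → ℕ → ℝ} {d : ℕ}
    (hM : ∀ j k, M j k ≤ 1) (S : ℕ → Finset ℕ) (hS : ∀ k, (S k).card ≤ d)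
    (hMS : ∀ j k, j ∉ S k → M j k = 0) : MatrixBounded r M := by
  refine ⟨d, ENNReal.natCast_ne_top d, fun x => ?_⟩
  have hcol : ∀ k, ∑' j, ENNReal.ofReal (M j k) ^ r ≤ d := by
    intro k
    rw [tsum_eq_sum (s := S k) fun j hj => by simp [hMS j k hj, hr]]
    refine (Finset.sum_le_card_nsmul _ _ 1 fun j _ => ?_).trans ?_
    · exact ENNReal.rpow_le_one (ENNReal.ofReal_le_one.2 (hM j k)) hr.le
    · rw [nsmul_one]
      exact_mod_cast hS k
  calc ∑' j, (∑' k, ENNReal.ofReal (M j k) * x k) ^ r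
      ≤ ∑' j, ∑' k, ENNReal.ofReal (M j k) ^ r * x k ^ r := by
        refine ENNReal.tsum_le_tsum fun j => (rpow_tsum_le_tsum_rpow hr hr1 _).trans (le_of_eq ?_)
        exact tsum_congr fun k => ENNReal.mul_rpow_of_nonneg _ _ hr.le
    _ = ∑' k, (∑' j, ENNReal.ofReal (M j k) ^ r) * x k ^ r := by
        rw [ENNReal.tsum_comm]
        exact tsum_congr fun k => ENNReal.tsum_mul_right
    _ ≤ ∑' k, d * x k ^ r := ENNReal.tsum_le_tsum fun k => mul_le_mul_left (hcol k) _
    _ = d * ∑' k, x k ^ r := ENNReal.tsum_mul_left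

end SeqInterp

/-! ### Monotone coupling of tail sums, and (a) ⇒ (c) -/

namespace SeqInterp

open Filter Topology

/-- The length of the intersection of the intervals `(B (j + 1), B j]` and `(A (k + 1), A k]`. -/
noncomputable def overlap (A B : ℕ → ℝ) (j k : ℕ) : ℝ :=
  max (B (j + 1)) (min (B j) (A k)) - max (B (j + 1)) (min (B j) (A (k + 1)))

section overlap

variable {A B : ℕ → ℝ}

theorem overlap_nonneg (hA : Antitone A) (j k : ℕ) : 0 ≤ overlap A B j k :=
  sub_nonneg.2 (max_le_max le_rfl (min_le_min le_rfl (hA (Nat.le_succ k))))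

theorem overlap_symm (hA : Antitone A) (hB : Antitone B) (j k : ℕ) :
    overlap A B j k = overlap B A k j := by
  have h1 := hA (Nat.le_succ k)
  have h2 := hB (Nat.le_succ j)
  unfold overlap
  simp only [Nat.succ_eq_add_one] at h1 h2
  simp only [max_def, min_def]
  split_ifs <;> linarith

theorem sum_range_overlap (N j : ℕ) : ∑ k ∈ Finset.range N, overlap A B j k =
    max (B (j + 1)) (min (B j) (A 0)) - max (B (j + 1)) (min (B j) (A N)) :=
  Finset.sum_range_sub' (fun k => max (B (j + 1)) (min (B j) (A k))) N

/-- Since `A` decreases to `0`, its intervals tile `(0, A 0]`, which contains `(B (j + 1), B j]`. -/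
theorem hasSum_overlap (hA : Antitone A) (hB : Antitone B) (hA0 : Tendsto A atTop (𝓝 0))
    (hB0 : ∀ n, 0 ≤ B n) (hBA : ∀ n, B n ≤ A n) (j : ℕ) :
    HasSum (overlap A B j) (B j - B (j + 1)) := by
  rw [hasSum_iff_tendsto_nat_of_nonneg (overlap_nonneg hA j)]
  simp_rw [sum_range_overlap]
  have h1 : max (B (j + 1)) (min (B j) (A 0)) = B j := by
    rw [min_eq_left ((hB (Nat.zero_le j)).trans (hBA 0)), max_eq_right (hB (Nat.le_succ j))]
  have h2 : max (B (j + 1)) (min (B j) 0) = B (j + 1) := by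
    rw [min_eq_right (hB0 j), max_eq_left (hB0 _)]
  rw [h1]
  refine tendsto_const_nhds.sub ?_
  have h3 : Tendsto (fun n => max (B (j + 1)) (min (B j) (A n))) atTop
      (𝓝 (max (B (j + 1)) (min (B j) 0))) := tendsto_const_nhds.max (tendsto_const_nhds.min hA0)
  rwa [h2] at h3

theorem sum_range_overlap_le (hA : Antitone A) (hB : Antitone B) (N k : ℕ) :
    ∑ j ∈ Finset.range N, overlap A B j k ≤ A k - A (k + 1) := by
  simp_rw [overlap_symm hA hB]
  rw [sum_range_overlap]
  have h := hA (Nat.le_succ k)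
  have h1 : max (A (k + 1)) (min (A k) (B 0)) ≤ A k := max_le h (min_le_left _ _)
  have h2 : A (k + 1) ≤ max (A (k + 1)) (min (A k) (B N)) := le_max_left _ _
  linarith

theorem overlap_le (hA : Antitone A) (hB : Antitone B) (j k : ℕ) :
    overlap A B j k ≤ A k - A (k + 1) :=
  (Finset.single_le_sum (f := fun j => overlap A B j k) (fun i _ => overlap_nonneg hA i k)
    (Finset.mem_range.2 (Nat.lt_succ_self j))).trans (sum_range_overlap_le hA hB _ k)

theorem lt_of_overlap_ne_zero (hA : Antitone A) (hB : Antitone B) {j k : ℕ}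
    (h : overlap A B j k ≠ 0) : B (j + 1) < A k ∧ A (k + 1) < B j := by
  have h1 := hA (Nat.le_succ k)
  have h2 := hB (Nat.le_succ j)
  constructor
  · by_contra hle
    rw [not_lt] at hle
    refine h ?_
    unfold overlap
    rw [max_eq_left ((min_le_right _ _).trans hle),
      max_eq_left ((min_le_right _ _).trans (h1.trans hle)), sub_self]
  · by_contra hle
    rw [not_lt] at hle
    refine h ?_
    unfold overlap
    rw [min_eq_left (hle.trans h1), min_eq_left hle, sub_self]

/-- For `j > k` one has `B j ≤ A j ≤ A (k + 1)`, so the `j`-th interval lies wholly below the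
`k`-th. -/
theorem le_of_overlap_ne_zero (hA : Antitone A) (hB : Antitone B) (hBA : ∀ n, B n ≤ A n) {j k : ℕ}
    (h : overlap A B j k ≠ 0) : j ≤ k := by
  by_contra hlt
  have h1 := (lt_of_overlap_ne_zero hA hB h).2
  have h2 := hBA j
  have h3 := hA (show k + 1 ≤ j by omega)
  linarith

/-- If every interval of the second family meeting `(A (k + 1), A k]` is at least as long as it,
then at most two of them meet it. -/
theorem exists_finset_overlap (hA : Antitone A) (hB : Antitone B) (hBA : ∀ n, B n ≤ A n)
    (hlen : ∀ j k, overlap A B j k ≠ 0 → A k - A (k + 1) ≤ B j - B (j + 1)) (k : ℕ) :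
    ∃ S : Finset ℕ, S.card ≤ 2 ∧ ∀ j, j ∉ S → overlap A B j k = 0 := by
  classical
  refine ⟨(Finset.range (k + 1)).filter fun j => overlap A B j k ≠ 0, ?_, fun j hj => ?_⟩
  · by_contra hcard
    -- With three intervals meeting `(A (k + 1), A k]`, the middle one is strictly shorter than it,
    -- against `hlen`.
    obtain ⟨j₁, j₂, j₃, h1, h2, h3, hlt, hlt'⟩ : ∃ j₁ j₂ j₃, overlap A B j₁ k ≠ 0 ∧
        overlap A B j₂ k ≠ 0 ∧ overlap A B j₃ k ≠ 0 ∧ j₁ < j₂ ∧ j₂ < j₃ := by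
      have hc : 2 < ((Finset.range (k + 1)).filter fun j => overlap A B j k ≠ 0).card := by omega
      rw [Finset.two_lt_card] at hc
      obtain ⟨a, ha, b, hb, c, hc, hab, hac, hbc⟩ := hc
      have ha := (Finset.mem_filter.1 ha).2
      have hb := (Finset.mem_filter.1 hb).2
      have hc := (Finset.mem_filter.1 hc).2
      rcases lt_or_gt_of_ne hab with h | h <;> rcases lt_or_gt_of_ne hac with h' | h' <;>
        rcases lt_or_gt_of_ne hbc with h'' | h''
      · exact ⟨a, b, c, ha, hb, hc, h, h''⟩
      · exact ⟨a, c, b, ha, hc, hb, h', h''⟩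
      · omega
      · exact ⟨c, a, b, hc, ha, hb, h', h⟩
      · exact ⟨b, a, c, hb, ha, hc, h, h'⟩
      · omega
      · exact ⟨b, c, a, hb, hc, ha, h'', h'⟩
      · exact ⟨c, b, a, hc, hb, ha, h'', h⟩
    have e1 := (lt_of_overlap_ne_zero hA hB h1).1
    have e3 := (lt_of_overlap_ne_zero hA hB h3).2
    have e2 := hlen _ _ h2
    have e4 := hB (show j₁ + 1 ≤ j₂ by omega)
    have e5 := hB (show j₂ + 1 ≤ j₃ by omega)
    linarith
  · by_contra hne
    refine hj (Finset.mem_filter.2 ⟨Finset.mem_range.2 ?_, hne⟩)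
    exact Nat.lt_succ_of_le (le_of_overlap_ne_zero hA hB hBA hne)

end overlap

/-- The matrix transporting `a` to `b` along the monotone coupling of their `q`-th powers. -/
theorem exists_transport_matrix {q : ℝ} (hq : 1 ≤ q) {a b A B : ℕ → ℝ}
    (ha0 : ∀ k, 0 ≤ a k) (hb0 : ∀ j, 0 ≤ b j) (ha : Antitone a)
    (hA : ∀ k, A k = a k ^ q + A (k + 1)) (hB : ∀ j, B j = b j ^ q + B (j + 1))
    (hA0 : Tendsto A atTop (𝓝 0)) (hB0 : ∀ n, 0 ≤ B n) (hBA : ∀ n, B n ≤ A n)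
    (hlt : ∀ j, b j ≠ 0 → a j ≤ b j) :
    ∃ M : ℕ → ℕ → ℝ, (∀ j k, 0 ≤ M j k) ∧
      (∀ r, 0 < r → r ≤ q → MatrixBounded r M) ∧
      ∀ j, ENNReal.ofReal (b j) = ∑' k, ENNReal.ofReal (M j k) * ENNReal.ofReal (a k) := by
  have hq0 : 0 < q := by linarith
  have hAanti : Antitone A := antitone_nat_of_succ_le fun k => by
    have := Real.rpow_nonneg (ha0 k) q
    linarith [hA k]
  have hBanti : Antitone B := antitone_nat_of_succ_le fun k => by
    have := Real.rpow_nonneg (hb0 k) q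
    linarith [hB k]
  have hdA : ∀ k, A k - A (k + 1) = a k ^ q := fun k => by linarith [hA k]
  have hdB : ∀ k, B k - B (k + 1) = b k ^ q := fun k => by linarith [hB k]
  set w := overlap A B with hw
  have hw0 : ∀ j k, 0 ≤ w j k := overlap_nonneg hAanti
  have hwa : ∀ j k, w j k ≤ a k ^ q := fun j k => (overlap_le hAanti hBanti j k).trans (hdA k).le
  have hwb : ∀ j k, w j k ≤ b j ^ q := fun j k => by
    rw [hw, overlap_symm hAanti hBanti]
    exact (overlap_le hBanti hAanti k j).trans (hdB j).le
  have hrow : ∀ j, HasSum (w j) (b j ^ q) := fun j => by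
    rw [← hdB]
    exact hasSum_overlap hAanti hBanti hA0 hB0 hBA j
  have hapos : ∀ j k, w j k ≠ 0 → 0 < a k := fun j k h => by
    refine lt_of_le_of_ne (ha0 k) fun h0 => h (le_antisymm ?_ (hw0 j k))
    have := hwa j k
    rwa [← h0, Real.zero_rpow hq0.ne'] at this
  have hbpos : ∀ j k, w j k ≠ 0 → 0 < b j := fun j k h => by
    refine lt_of_le_of_ne (hb0 j) fun h0 => h (le_antisymm ?_ (hw0 j k))
    have := hwb j k
    rwa [← h0, Real.zero_rpow hq0.ne'] at this
  -- Overlap forces `j ≤ k`, hence `a k ≤ a j ≤ b j`. All the boundedness below rests on this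
  -- comparison.
  have hab : ∀ j k, w j k ≠ 0 → a k ≤ b j := fun j k h =>
    (ha (le_of_overlap_ne_zero hAanti hBanti hBA h)).trans (hlt j (hbpos j k h).ne')
  have hM0 : ∀ j k, 0 ≤ w j k / b j ^ q * (b j / a k) := fun j k =>
    mul_nonneg (div_nonneg (hw0 j k) (Real.rpow_nonneg (hb0 j) q)) (div_nonneg (hb0 j) (ha0 k))
  -- The first factor is a probability weight in `k` when `b j ≠ 0`; the second rescales `a k` to `b
  -- j`. If `a k` or `b j` vanishes, so does `w j k`, and division by zero is harmless.
  refine ⟨fun j k => w j k / b j ^ q * (b j / a k), hM0, ?_, ?_⟩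
  · intro r hr hrq
    rcases le_total r 1 with hr1 | hr1
    · choose S hS hS0 using exists_finset_overlap hAanti hBanti hBA fun j k h => by
        rw [hdA, hdB]
        exact Real.rpow_le_rpow (ha0 k) (hab j k h) hq0.le
      refine matrixBounded_of_le_one hr hr1 (d := 2) (fun j k => ?_) S hS fun j k hj => ?_
      · by_cases h : w j k = 0
        · simp [h]
        have h1 := hapos j k h
        have h2 := hbpos j k h
        have h3 : a k ^ (q - 1) ≤ b j ^ (q - 1) :=
          Real.rpow_le_rpow (ha0 k) (hab j k h) (by linarith)
        rw [div_mul_div_comm, div_le_one (by positivity)]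
        calc w j k * b j ≤ a k ^ q * b j := by gcongr; exact hwa j k
          _ = a k ^ (q - 1) * a k * b j := by
            rw [Real.rpow_sub_one h1.ne', div_mul_cancel₀ _ h1.ne']
          _ ≤ b j ^ (q - 1) * a k * b j := by gcongr
          _ = b j ^ q * a k := by
            rw [Real.rpow_sub_one h2.ne']
            field_simp
      · have : w j k = 0 := hS0 k j hj
        simp [this]
    · refine matrixBounded_of_one_le hr1 (w := fun j k => w j k / b j ^ q)
        (c := fun j k => b j / a k) (fun j k => div_nonneg (hw0 j k) (Real.rpow_nonneg (hb0 j) q))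
        (fun j k => div_nonneg (hb0 j) (ha0 k)) (fun _ _ => rfl) (fun j => ?_) fun k => ?_
      · have := (hrow j).div_const (b j ^ q)
        rw [← ENNReal.ofReal_tsum_of_nonneg
          (fun k => div_nonneg (hw0 j k) (Real.rpow_nonneg (hb0 j) q)) this.summable, this.tsum_eq]
        exact ENNReal.ofReal_le_one.2 (div_self_le_one _)
      · refine ENNReal.tsum_le_of_sum_range_le fun N => ?_
        rw [← ENNReal.ofReal_sum_of_nonneg fun j _ => mul_nonneg
          (div_nonneg (hw0 j k) (Real.rpow_nonneg (hb0 j) q))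
          (Real.rpow_nonneg (div_nonneg (hb0 j) (ha0 k)) r)]
        refine ENNReal.ofReal_le_one.2 ?_
        calc ∑ j ∈ Finset.range N, w j k / b j ^ q * (b j / a k) ^ r
            ≤ ∑ j ∈ Finset.range N, w j k / a k ^ q := by
              refine Finset.sum_le_sum fun j _ => ?_
              by_cases h : w j k = 0
              · simp [h]
              have h1 := hapos j k h
              have h2 := hbpos j k h
              -- The ratio is at least one, so `r ≤ q` reduces the column sum to the case `r = q`,
              -- where `b j` cancels.
              have h3 : (b j / a k) ^ r ≤ (b j / a k) ^ q :=
                Real.rpow_le_rpow_of_exponent_le ((one_le_div h1).2 (hab j k h)) hrq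
              calc w j k / b j ^ q * (b j / a k) ^ r ≤ w j k / b j ^ q * (b j / a k) ^ q := by
                    gcongr
                    exact div_nonneg (hw0 j k) (Real.rpow_nonneg (hb0 j) q)
                _ = w j k / a k ^ q := by
                    rw [Real.div_rpow h2.le h1.le]
                    have := (Real.rpow_pos_of_pos h2 q).ne'
                    field_simp
          _ = (∑ j ∈ Finset.range N, w j k) / a k ^ q := (Finset.sum_div _ _ _).symm
          _ ≤ a k ^ q / a k ^ q := by
              gcongr
              · exact Real.rpow_nonneg (ha0 k) q
              · exact (sum_range_overlap_le hAanti hBanti N k).trans (hdA k).le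
          _ ≤ 1 := div_self_le_one _
  · intro j
    have h1 : ∀ k, ENNReal.ofReal (w j k / b j ^ q * (b j / a k)) * ENNReal.ofReal (a k) =
        ENNReal.ofReal (w j k * (b j / b j ^ q)) := by
      intro k
      rw [← ENNReal.ofReal_mul (hM0 j k)]
      congr 1
      by_cases h : w j k = 0
      · simp [h]
      have h1 := hapos j k h
      field_simp
    have h2 := (hrow j).mul_right (b j / b j ^ q)
    simp only [h1]
    rw [← ENNReal.ofReal_tsum_of_nonneg (fun k => mul_nonneg (hw0 j k)
      (div_nonneg (hb0 j) (Real.rpow_nonneg (hb0 j) q))) h2.summable, h2.tsum_eq]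
    congr 1
    by_cases h : b j = 0
    · simp [h]
    have : b j ^ q ≠ 0 := (Real.rpow_pos_of_pos (lt_of_le_of_ne (hb0 j) (Ne.symm h)) q).ne'
    field_simp

variable {𝕜 : Type*} [RCLike 𝕜]

theorem exists_decreasing_enumeration_norm {q : ℝ} (hq : 0 < q) {u : ℕ → 𝕜}
    (hu : ∑' k, ‖u k‖ₑ ^ q ≠ ∞) : ∃ σ : ℕ → ℕ, Function.Injective σ ∧
      Antitone (fun i => ‖u (σ i)‖) ∧ (∀ k, k ∉ Set.range σ → u k = 0) ∧
      ∀ (n : ℕ) (F : Finset ℕ), F.card ≤ n →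
        ∑' i, ‖u (σ (n + i))‖ₑ ^ q ≤ sumOff (fun k => ‖u k‖ₑ ^ q) F := by
  obtain ⟨σ, hσ, hanti, h0⟩ := exists_decreasing_enumeration (fun k => ‖u k‖ₑ ^ q)
    fun ε hε => ENNReal.finite_const_le_of_tsum_ne_top hu hε.ne'
  refine ⟨σ, hσ, fun i j hij => ?_, fun k hk => ?_, fun n F hF => ?_⟩
  · have := (ENNReal.rpow_le_rpow_iff hq).1 (hanti hij)
    exact enorm_le_iff_norm_le.1 this
  · simpa [hq, hq.le] using h0 k hk
  · exact tsum_nat_add_le_sumOff_of_enumeration (φ := fun k => ‖u k‖ₑ ^ q) hσ hanti h0 hF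

theorem IsInterpolationSpace.mem_of_tailMajorizedPow {E : NormedSeqSpace 𝕜}
    (hE : E.IsQuasiBanach) {p q : ℝ} (hp : 0 < p) (hpq : p < q) (hq : 1 ≤ q)
    (h : IsInterpolationSpace (ellp 𝕜 (ENNReal.ofReal p)) (ellp 𝕜 (ENNReal.ofReal q)) E)
    {u v : ℕ → 𝕜} (hu : u ∈ E.carrier) (hvu : TailMajorizedPow q v u) : v ∈ E.carrier := by
  have hq0 : 0 < q := by linarith
  rw [tailMajorizedPow_iff hq0.le] at hvu
  have hVq := sup_eq_right.2 (ellp_mono (𝕜 := 𝕜) (ENNReal.ofReal_le_ofReal hpq.le))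
  have husum : ∑' k, ‖u k‖ₑ ^ q ≠ ∞ := by
    rw [← mem_ellp_iff hq0, ← hVq]
    exact h.2.1 hu
  have hvsum : ∑' k, ‖v k‖ₑ ^ q ≠ ∞ := by
    obtain ⟨F', hF', hle⟩ := hvu ∅
    obtain rfl : F' = ∅ := by simpa using hF'
    rw [sumOff_empty, sumOff_empty] at hle
    exact ne_top_of_le_ne_top husum hle
  obtain ⟨σ, hσ, hσanti, hσ0, -⟩ := exists_decreasing_enumeration_norm hq0 husum
  obtain ⟨ρ, hρ, hρanti, hρ0, hρtail⟩ := exists_decreasing_enumeration_norm hq0 hvsum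
  have hmaj : ∀ n, ∑' i, ‖v (ρ (n + i))‖ₑ ^ q ≤ ∑' i, ‖u (σ (n + i))‖ₑ ^ q := by
    intro n
    obtain ⟨F', hF', hle⟩ := hvu ((Finset.range n).image σ)
    refine (hρtail n F' (hF'.trans (Finset.card_image_le.trans (by simp)))).trans (hle.trans ?_)
    rw [sumOff_image_range (φ := fun k => ‖u k‖ₑ ^ q) hσ fun k hk => by simp [hσ0 k hk, hq0]]
  have hind0 : ∀ P : Prop, ∀ [Decidable P], (0 : ℝ) ≤ if P then 1 else 0 := fun P _ => by
    split_ifs <;> norm_num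
  -- Rearrangement invariance of `E` is not assumed; it comes from interpolating reindexing
  -- matrices.
  have hσE : (fun i => u (σ i)) ∈ E.carrier := by
    refine h.mem_of_le_matrix hE hp hpq.le (M := fun j k => if k = σ j then 1 else 0)
      (fun j k => hind0 _) (matrixBounded_comp hσ) (matrixBounded_comp hσ) hu fun j => ?_
    rw [tsum_eq_single (σ j) fun k hk => by simp [hk]]
    simp
  suffices hρE : (fun i => v (ρ i)) ∈ E.carrier by
    refine h.mem_of_le_matrix hE hp hpq.le (M := fun j k => if j = ρ k then 1 else 0)
      (fun j k => hind0 _) (matrixBounded_extend hp hρ) (matrixBounded_extend hq0 hρ) hρE fun j => ?_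
    by_cases hj : j ∈ Set.range ρ
    · obtain ⟨i, rfl⟩ := hj
      refine le_trans ?_ (ENNReal.le_tsum i)
      simp
    · simp [hρ0 j hj]
  let a : ℕ → ℝ := fun i => ‖u (σ i)‖
  -- Only the terms of `v` exceeding the corresponding term of `u` need transport; the others are
  -- bounded by `a`, which is why `a + b` dominates sorted `v`.
  let b : ℕ → ℝ := fun i => if ‖u (σ i)‖ < ‖v (ρ i)‖ then ‖v (ρ i)‖ else 0
  let tail : (ℕ → ℝ) → ℕ → ℝ := fun f n => (∑' i, ENNReal.ofReal (f (n + i)) ^ q).toReal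
  have ha0 : ∀ i, 0 ≤ a i := fun i => norm_nonneg _
  have hb0 : ∀ i, 0 ≤ b i := fun i => by
    simp only [b]
    split_ifs
    · exact norm_nonneg _
    · exact le_rfl
  have hea : ∀ i, ENNReal.ofReal (a i) = ‖u (σ i)‖ₑ := fun i => ofReal_norm _
  have heb : ∀ i, ENNReal.ofReal (b i) ≤ ‖v (ρ i)‖ₑ := fun i => by
    simp only [b]
    split_ifs
    · rw [ofReal_norm]
    · simp
  have hshift : ∀ (f : ℕ → ℝ≥0∞) n, ∑' i, f i ≠ ∞ → ∑' i, f (n + i) ≠ ∞ := fun f n hf =>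
    ne_top_of_le_ne_top hf (ENNReal.tsum_comp_le_tsum_of_injective (add_right_injective n) f)
  have hasum : ∑' i, ENNReal.ofReal (a i) ^ q ≠ ∞ := by
    simp_rw [hea]
    exact ne_top_of_le_ne_top husum
      (ENNReal.tsum_comp_le_tsum_of_injective hσ fun k => ‖u k‖ₑ ^ q)
  have hba : ∀ n, ∑' i, ENNReal.ofReal (b (n + i)) ^ q ≤ ∑' i, ENNReal.ofReal (a (n + i)) ^ q := by
    intro n
    simp_rw [hea]
    refine le_trans (ENNReal.tsum_le_tsum fun i => ?_) (hmaj n)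
    exact ENNReal.rpow_le_rpow (heb _) hq0.le
  have hbsum : ∑' i, ENNReal.ofReal (b i) ^ q ≠ ∞ := by
    refine ne_top_of_le_ne_top hasum ?_
    simpa using hba 0
  have htail : ∀ f : ℕ → ℝ, (∀ i, 0 ≤ f i) → ∑' i, ENNReal.ofReal (f i) ^ q ≠ ∞ → ∀ n,
      tail f n = f n ^ q + tail f (n + 1) := by
    intro f hf0 hf n
    have h1 : ∑' i, ENNReal.ofReal (f (n + i)) ^ q =
        ENNReal.ofReal (f n) ^ q + ∑' i, ENNReal.ofReal (f (n + 1 + i)) ^ q := by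
      rw [tsum_eq_zero_add' ENNReal.summable]
      congr 1
      refine tsum_congr fun i => ?_
      rw [show n + (i + 1) = n + 1 + i by ring]
    simp only [tail]
    rw [h1, ENNReal.toReal_add (by finiteness)
      (hshift (fun i => ENNReal.ofReal (f i) ^ q) (n + 1) hf), ← ENNReal.toReal_rpow,
      ENNReal.toReal_ofReal (hf0 n)]
  obtain ⟨M, hM0, hMbd, hMb⟩ := exists_transport_matrix hq (A := tail a) (B := tail b) ha0 hb0
    hσanti (htail a ha0 hasum) (htail b hb0 hbsum) (by
      have := ENNReal.tendsto_sum_nat_add (fun i => ENNReal.ofReal (a i) ^ q) hasum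
      have := (ENNReal.tendsto_toReal ENNReal.zero_ne_top).comp this
      simpa [Function.comp_def, add_comm, tail] using this)
    (fun n => ENNReal.toReal_nonneg)
    (fun n => ENNReal.toReal_mono (hshift (fun i => ENNReal.ofReal (a i) ^ q) n hasum) (hba n))
    (fun j hj => by
      simp only [b] at hj ⊢
      split_ifs at hj ⊢ with hlt
      · exact hlt.le
      · exact absurd rfl hj)
  have hbE : (fun i => ((b i : ℝ) : 𝕜)) ∈ E.carrier := by
    refine h.mem_of_le_matrix hE hp hpq.le hM0 (hMbd p hp hpq.le) (hMbd q hq0 le_rfl) hσE fun j => ?_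
    rw [← ofReal_norm, RCLike.norm_ofReal, abs_of_nonneg (hb0 j), hMb]
    simp_rw [hea]
    exact le_rfl
  have haE : (fun i => ((a i : ℝ) : 𝕜)) ∈ E.carrier :=
    (hE.mem_and_nm_le hσE fun i => by simp [a]).1
  refine (hE.mem_and_nm_le (E.carrier.add_mem haE hbE) fun i => ?_).1
  simp only [Pi.add_apply]
  rw [← RCLike.ofReal_add, RCLike.norm_ofReal, abs_of_nonneg (add_nonneg (ha0 i) (hb0 i))]
  simp only [a, b]
  split_ifs with hlt
  · linarith [norm_nonneg (u (σ i))]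
  · linarith

end SeqInterp

/-! ### Stability of tail domination, and (c) ⇒ (b) -/

namespace SeqInterp

open Filter Topology

theorem TailDominated.tsum_le {ψ φ : ℕ → ℝ≥0∞} (h : TailDominated ψ φ) :
    ∑' k, ψ k ≤ ∑' k, φ k := by
  obtain ⟨F', hF', hle⟩ := h ∅
  obtain rfl : F' = ∅ := by simpa using hF'
  rwa [sumOff_empty, sumOff_empty] at hle

theorem sumOff_const_mul (c : ℝ≥0∞) (φ : ℕ → ℝ≥0∞) (F : Finset ℕ) :
    sumOff (fun k => c * φ k) F = c * sumOff φ F := by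
  rw [sumOff, sumOff, ← ENNReal.tsum_mul_left]
  refine tsum_congr fun k => ?_
  by_cases hk : k ∈ F <;> simp [Set.indicator, hk]

theorem TailDominated.const_mul {ψ φ : ℕ → ℝ≥0∞} (h : TailDominated ψ φ) (c : ℝ≥0∞) :
    TailDominated (fun k => c * ψ k) fun k => c * φ k := by
  intro F
  obtain ⟨F', hF', hle⟩ := h F
  refine ⟨F', hF', ?_⟩
  rw [sumOff_const_mul, sumOff_const_mul]
  gcongr

theorem tailDominated_comp (φ : ℕ → ℝ≥0∞) {τ : ℕ → ℕ} (hτ : Function.Injective τ) :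
    TailDominated (fun k => φ (τ k)) φ := by
  classical
  intro F
  refine ⟨F.preimage τ hτ.injOn, by rw [Finset.card_preimage]; exact Finset.card_filter_le _ _, ?_⟩
  refine le_trans (le_of_eq (tsum_congr fun k => ?_))
    (ENNReal.tsum_comp_le_tsum_of_injective hτ (((F : Set ℕ)ᶜ).indicator φ))
  simp [Set.indicator]

theorem tailDominated_of_extend {ψ φ : ℕ → ℝ≥0∞} {τ : ℕ → ℕ} (hτ : Function.Injective τ)
    (h : ∀ k, ψ (τ k) = φ k) (h0 : ∀ k, k ∉ Set.range τ → ψ k = 0) : TailDominated ψ φ := by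
  classical
  intro F
  refine ⟨F.image τ, Finset.card_image_le, ?_⟩
  rw [sumOff, tsum_eq_tsum_comp_of_injective hτ fun k hk => by simp [Set.indicator, h0 k hk]]
  refine le_of_eq (tsum_congr fun k => ?_)
  by_cases hk : k ∈ F <;> simp [Set.indicator, hτ.eq_iff, hk, h]

theorem sumOff_unpair (φ : ℕ → ℕ → ℝ≥0∞) {G : Finset ℕ} {H : ℕ → Finset ℕ}
    (hGH : ∀ n m, Nat.pair n m ∈ G ↔ m ∈ H n) :
    sumOff (fun k => φ k.unpair.1 k.unpair.2) G = ∑' n, sumOff (φ n) (H n) := by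
  rw [sumOff, ← Nat.pairEquiv.tsum_eq, ENNReal.tsum_prod']
  refine tsum_congr fun n => tsum_congr fun m => ?_
  have e : Nat.pairEquiv (n, m) = Nat.pair n m := rfl
  rw [e]
  by_cases hm : m ∈ H n
  · rw [Set.indicator_of_notMem (by simpa using (hGH n m).2 hm),
      Set.indicator_of_notMem (by simpa using hm)]
  · rw [Set.indicator_of_mem (by simpa using fun h => hm ((hGH n m).1 h)),
      Set.indicator_of_mem (by simpa using hm), Nat.unpair_pair]

/-- Tail domination is preserved by direct sums. -/
theorem tailDominated_unpair {ψ φ : ℕ → ℕ → ℝ≥0∞} (h : ∀ n, TailDominated (ψ n) (φ n)) :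
    TailDominated (fun k => ψ k.unpair.1 k.unpair.2) fun k => φ k.unpair.1 k.unpair.2 := by
  classical
  intro F
  have hinj : ∀ n, Function.Injective (Nat.pair n) := fun n a b hab => (Nat.pair_eq_pair.1 hab).2
  let H : ℕ → Finset ℕ := fun n => F.preimage (Nat.pair n) (hinj n).injOn
  have hH : ∀ n m, Nat.pair n m ∈ F ↔ m ∈ H n := fun n m => by simp [H]
  choose H' hcard hle using fun n => h n (H n)
  let I := F.image fun k => k.unpair.1
  refine ⟨I.biUnion fun n => (H' n).image (Nat.pair n), ?_, ?_⟩
  · calc (I.biUnion fun n => (H' n).image (Nat.pair n)).card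
        ≤ ∑ n ∈ I, ((H' n).image (Nat.pair n)).card := Finset.card_biUnion_le
      _ ≤ ∑ n ∈ I, (F.filter fun k => k.unpair.1 = n).card := by
          refine Finset.sum_le_sum fun n _ => ?_
          refine Finset.card_image_le.trans ((hcard n).trans ?_)
          rw [← Finset.card_image_of_injective (H n) (hinj n)]
          refine Finset.card_le_card fun k hk => ?_
          obtain ⟨m, hm, rfl⟩ := Finset.mem_image.1 hk
          exact Finset.mem_filter.2 ⟨(hH n m).2 hm, by simp⟩
      _ = F.card := (Finset.card_eq_sum_card_image _ F).symm
  · rw [sumOff_unpair φ hH, sumOff_unpair ψ (H := H')]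
    · exact ENNReal.tsum_le_tsum hle
    · intro n m
      constructor
      · intro hmem
        obtain ⟨n', -, hn'⟩ := Finset.mem_biUnion.1 hmem
        obtain ⟨m', hm', he⟩ := Finset.mem_image.1 hn'
        obtain ⟨rfl, rfl⟩ := Nat.pair_eq_pair.1 he
        exact hm'
      · intro hm
        refine Finset.mem_biUnion.2 ⟨n, ?_, Finset.mem_image_of_mem _ hm⟩
        -- If a term is deleted in block `n` on the left, then `F` meets that block, so `n` belongs
        -- to `I`.
        have hpos : 0 < (H n).card := (Finset.card_pos.2 ⟨m, hm⟩).trans_le (hcard n)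
        obtain ⟨l, hl⟩ := Finset.card_pos.1 hpos
        exact Finset.mem_image.2 ⟨Nat.pair n l, (hH n l).2 hl, by simp⟩

variable {𝕜 : Type*} [RCLike 𝕜] {E : NormedSeqSpace 𝕜} {q : ℝ}

/-- A divergent sum stays infinite after finite deletions, so such a `u` would tail-dominate every
bounded sequence and `E` would be all of `ℓ_∞`. -/
theorem summable_of_closed_under_tailMajorization (hq : 0 < q)
    (hE_sub : E.carrier ≤ (ellp 𝕜 ∞).carrier) (hE_ne_top : E.carrier ≠ (ellp 𝕜 ∞).carrier)
    (hc : ∀ (u : E.carrier) (v : ℕ → 𝕜), v ∈ (ellp 𝕜 ∞).carrier →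
      TailMajorizedPow q v u → v ∈ E.carrier) {u : ℕ → 𝕜} (hu : u ∈ E.carrier) :
    ∑' k, ‖u k‖ₑ ^ q ≠ ∞ := by
  intro htop
  refine hE_ne_top (le_antisymm hE_sub fun v hv => hc ⟨u, hu⟩ v hv ?_)
  rw [tailMajorizedPow_iff hq.le]
  intro F
  refine ⟨∅, by simp, le_top.trans (top_le_iff.2 ?_)⟩
  have h1 := sum_add_sumOff (fun k => ‖u k‖ₑ ^ q) F
  rw [htop, ENNReal.add_eq_top] at h1
  refine h1.resolve_left ?_
  rw [← ne_eq, ← lt_top_iff_ne_top, ENNReal.sum_lt_top]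
  intro k _
  exact ENNReal.rpow_lt_top_of_nonneg hq.le (by simp)

theorem mem_ellp_top_of_tailDominated (hq : 0 < q) {u v : ℕ → 𝕜} (hu : ∑' k, ‖u k‖ₑ ^ q ≠ ∞)
    (h : TailDominated (fun k => ‖v k‖ₑ ^ q) fun k => ‖u k‖ₑ ^ q) : v ∈ (ellp 𝕜 ∞).carrier :=
  ellp_mono le_top ((mem_ellp_iff hq v).2 (ne_top_of_le_ne_top hu h.tsum_le))

theorem enorm_smul_rpow (hq : 0 ≤ q) (a : 𝕜) (x : ℕ → 𝕜) :
    (fun k => ‖(a • x) k‖ₑ ^ q) = fun k => ‖a‖ₑ ^ q * ‖x k‖ₑ ^ q := by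
  funext k
  rw [Pi.smul_apply, enorm_smul, ENNReal.mul_rpow_of_nonneg _ _ hq]

/-- Closedness under tail majorization is automatically uniform. -/
theorem exists_bound_of_closed_under_tailDomination (hE : E.IsQuasiBanach) (hq : 0 < q)
    (hc : ∀ u ∈ E.carrier, ∀ v : ℕ → 𝕜,
      TailDominated (fun k => ‖v k‖ₑ ^ q) (fun k => ‖u k‖ₑ ^ q) → v ∈ E.carrier) :
    ∃ c : ℝ, 0 < c ∧ ∀ u ∈ E.carrier, ∀ v : ℕ → 𝕜,
      TailDominated (fun k => ‖v k‖ₑ ^ q) (fun k => ‖u k‖ₑ ^ q) → E.nm v ≤ c * E.nm u := by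
  obtain ⟨K, hK1, hK⟩ := hE.exists_add_const
  have hK0 : 0 < 2 * K := by linarith
  have hinj : ∀ n, Function.Injective (Nat.pair n) := fun n a b hab => (Nat.pair_eq_pair.1 hab).2
  -- `ι n` places a sequence on the `n`-th copy of `ℕ` under `Nat.pair`, and `π n` reads that copy.
  -- Their bounds `C n`, `D n` may grow with `n`; the choice of the violating pairs compensates.
  let ι : ℕ → (ℕ → 𝕜) → ℕ → 𝕜 := fun n x k => if k.unpair.1 = n then x k.unpair.2 else 0
  let π : ℕ → (ℕ → 𝕜) → ℕ → 𝕜 := fun n x m => x (Nat.pair n m)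
  have hι : ∀ n, ∃ C : ℝ, 0 < C ∧ ∀ x ∈ E.carrier, E.nm (ι n x) ≤ C * E.nm x ∧ ι n x ∈ E.carrier := by
    intro n
    have hmem : ∀ x ∈ E.carrier, ι n x ∈ E.carrier := by
      intro x hx
      refine hc x hx _ (tailDominated_of_extend (hinj n) (fun k => by simp [ι]) fun k hk => ?_)
      have : k.unpair.1 ≠ n := fun h => hk ⟨k.unpair.2, by rw [← h, Nat.pair_unpair]⟩
      simp [ι, this, hq]
    obtain ⟨C, hC, hb⟩ := hE.exists_bound_of_monotone (ι n)
      (fun a x => by funext k; simp [ι]) (fun x y hxy k => by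
        simp only [ι]
        split_ifs
        · exact hxy _
        · exact le_rfl) hmem
    exact ⟨C, hC, fun x hx => ⟨hb x hx, hmem x hx⟩⟩
  have hπ : ∀ n, ∃ D : ℝ, 0 < D ∧ ∀ x ∈ E.carrier, E.nm (π n x) ≤ D * E.nm x := fun n =>
    hE.exists_bound_of_monotone (π n) (fun a x => rfl) (fun x y hxy k => hxy _) fun x hx =>
      hc x hx _ (tailDominated_comp (fun k => ‖x k‖ₑ ^ q) (hinj n))
  choose C hC0 hC using hι
  choose D hD0 hD using hπ
  by_contra! hcon
  have hsel : ∀ n : ℕ, ∃ u ∈ E.carrier, ∃ v : ℕ → 𝕜,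
      TailDominated (fun k => ‖v k‖ₑ ^ q) (fun k => ‖u k‖ₑ ^ q) ∧
      C n * E.nm u ≤ ((2 * K) ^ (n + 1))⁻¹ ∧ D n * n < E.nm v := by
    intro n
    have hCn := hC0 n
    have hDn := hD0 n
    obtain ⟨u, hu, v, hvu, hlt⟩ := hcon (D n * (n + 1) * (C n * (2 * K) ^ (n + 1))) (by positivity)
    have hpos : 0 < E.nm u := by
      refine lt_of_le_of_ne (hE.nm_nonneg _) fun h => ?_
      have hu0 := hE.eq_zero_of_nm_eq_zero hu h.symm
      have hv0 : v = 0 := by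
        have h1 := hvu.tsum_le
        rw [hu0] at h1
        simp only [Pi.zero_apply, enorm_zero, ENNReal.zero_rpow_of_pos hq, tsum_zero,
          nonpos_iff_eq_zero, ENNReal.tsum_eq_zero] at h1
        funext k
        simpa [hq, hq.le] using h1 k
      rw [hv0, ← h, hE.nm_zero] at hlt
      simp at hlt
    set s : ℝ := (C n * (2 * K) ^ (n + 1) * E.nm u)⁻¹ with hs
    have hs0 : 0 < s := by positivity
    have hsn : ‖((s : ℝ) : 𝕜)‖ = s := by rw [RCLike.norm_ofReal, abs_of_pos hs0]
    refine ⟨(s : 𝕜) • u, E.carrier.smul_mem _ hu, (s : 𝕜) • v, ?_, ?_, ?_⟩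
    · rw [enorm_smul_rpow hq.le, enorm_smul_rpow hq.le]
      exact hvu.const_mul _
    · rw [hE.nm_smul _ hu, hsn, hs]
      refine le_of_eq ?_
      field_simp
    · rw [hE.nm_smul _ (hc u hu v hvu), hsn]
      calc D n * n < D n * (n + 1) := by
            gcongr
            linarith
        _ = s * (D n * (n + 1) * (C n * (2 * K) ^ (n + 1)) * E.nm u) := by
            rw [hs]
            field_simp
        _ < s * E.nm v := by gcongr
  choose u hu v hvu hun hvn using hsel
  obtain ⟨y, hy, -, hdom⟩ := hE.exists_majorant hK1 hK (A := 1) (fun n => (hC n (u n) (hu n)).2)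
    fun n => by
      rw [one_mul]
      exact (hC n (u n) (hu n)).1.trans (hun n)
  have hU : (fun k : ℕ => u k.unpair.1 k.unpair.2) ∈ E.carrier := by
    refine (hE.mem_and_nm_le hy fun k => ?_).1
    have := hdom k.unpair.1 k
    simpa [ι] using this
  have hV : (fun k : ℕ => v k.unpair.1 k.unpair.2) ∈ E.carrier :=
    hc _ hU _ (tailDominated_unpair (ψ := fun n k => ‖v n k‖ₑ ^ q)
      (φ := fun n k => ‖u n k‖ₑ ^ q) hvu)
  obtain ⟨n, hn⟩ := exists_nat_gt (E.nm fun k : ℕ => v k.unpair.1 k.unpair.2)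
  -- Reading block `n` of the glued sequence gives `D n * n < ‖v n‖ ≤ D n * ‖V‖`, impossible once
  -- `n` exceeds `‖V‖`.
  have h1 := hD n _ hV
  have h2 : π n (fun k : ℕ => v k.unpair.1 k.unpair.2) = v n := by
    funext m
    simp [π]
  rw [h2] at h1
  exact lt_irrefl _ (lt_of_mul_lt_mul_left ((hvn n).trans_le h1) (hD0 n).le |>.trans hn)

end SeqInterp

/-! ### Dyadic averages and a weak-type estimate -/

namespace SeqInterp

open Filter Topology

theorem sum_range_inv_sqrt_le (n : ℕ) :
    ∑ i ∈ Finset.range n, (√((i : ℝ) + 1))⁻¹ ≤ 2 * √(n : ℝ) := by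
  induction n with
  | zero => simp
  | succ n ih =>
    rw [Finset.sum_range_succ]
    push_cast
    have h1 : 0 < √((n : ℝ) + 1) := Real.sqrt_pos.2 (by positivity)
    have h2 : √((n : ℝ) + 1) ^ 2 = n + 1 := Real.sq_sqrt (by positivity)
    have h3 : √(n : ℝ) ^ 2 = n := Real.sq_sqrt (by positivity)
    have h4 : 0 ≤ √(n : ℝ) := Real.sqrt_nonneg _
    have h5 : (√((n : ℝ) + 1))⁻¹ ≤ 2 * √((n : ℝ) + 1) - 2 * √(n : ℝ) := by
      rw [inv_le_iff_one_le_mul₀ h1]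
      nlinarith [sq_nonneg (√((n : ℝ) + 1) - √(n : ℝ))]
    linarith

/-- Take the least `j` with `k < 2 ^ j * (i + 1)`; minimality costs the factor `2`. -/
theorem exists_two_pow_scale {i k : ℕ} (h : i ≤ k) :
    ∃ j : ℕ, k / 2 ^ j ≤ i ∧ 2 ^ j * (i + 1) ≤ 2 * (k + 1) := by
  have hex : ∃ j : ℕ, k < 2 ^ j * (i + 1) := ⟨k, by
    have : k < 2 ^ k := Nat.lt_two_pow_self
    nlinarith⟩
  classical
  refine ⟨Nat.find hex, ?_, ?_⟩
  · have := Nat.find_spec hex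
    rw [← Nat.lt_succ_iff, Nat.div_lt_iff_lt_mul (by positivity)]
    rwa [mul_comm]
  · cases hj : Nat.find hex with
    | zero => omega
    | succ j =>
      have := Nat.find_min hex (show j < Nat.find hex by omega)
      rw [pow_succ]
      nlinarith

/-- A decreasing sequence whose dyadic dilations grow at most like `2 ^ (m * j)` at `k` has
controlled `p`-averages up to `k`, where `p = 1 / (2 * m)`. -/
theorem sum_rpow_le_of_dyadic_bound {a : ℕ → ℝ} (ha : Antitone a) (ha0 : ∀ i, 0 ≤ a i) {m k : ℕ}
    (hm : 0 < m) {Y : ℝ} (hY : 0 ≤ Y) (h : ∀ j, a (k / 2 ^ j) ≤ (2 ^ m) ^ j * Y) :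
    ∑ i ∈ Finset.range (k + 1), a i ^ (1 / (2 * (m : ℝ))) ≤
      4 * (k + 1) * Y ^ (1 / (2 * (m : ℝ))) := by
  set p : ℝ := 1 / (2 * (m : ℝ)) with hp
  have hm0 : (0 : ℝ) < m := by exact_mod_cast hm
  have hp0 : 0 < p := by positivity
  -- With `2 ^ j` at most `2 * (k + 1) / (i + 1)`, the exponent `1 / (2 * m)` turns the growth `2 ^
  -- (m * j)` into `2 ^ (j / 2)`, leaving the decay `(i + 1) ^ (-1/2)`, whose sum up to `k` is of
  -- order `√(k + 1)`.
  have hterm : ∀ i ∈ Finset.range (k + 1),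
      a i ^ p ≤ 2 * √((k : ℝ) + 1) * Y ^ p * (√((i : ℝ) + 1))⁻¹ := by
    intro i hi
    obtain ⟨j, hj1, hj2⟩ := exists_two_pow_scale (Nat.lt_succ_iff.1 (Finset.mem_range.1 hi))
    have h1 : a i ≤ (2 ^ m) ^ j * Y := (ha hj1).trans (h j)
    have h2 : (((2 : ℝ) ^ m) ^ j) ^ p = √(2 ^ j) := by
      rw [Real.sqrt_eq_rpow, ← Real.rpow_natCast, ← Real.rpow_natCast, ← Real.rpow_natCast,
        ← Real.rpow_mul (by norm_num), ← Real.rpow_mul (by norm_num), ← Real.rpow_mul (by norm_num)]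
      congr 1
      rw [hp]
      field_simp
    have hi0 : 0 < √((i : ℝ) + 1) := Real.sqrt_pos.2 (by positivity)
    have h3 : √((2 : ℝ) ^ j) * √((i : ℝ) + 1) ≤ 2 * √((k : ℝ) + 1) := by
      rw [← Real.sqrt_mul (by positivity)]
      calc √((2 : ℝ) ^ j * (i + 1)) ≤ √(2 ^ 2 * (k + 1)) := by
            apply Real.sqrt_le_sqrt
            have : ((2 : ℝ) ^ j * (i + 1)) ≤ 2 * (k + 1) := by exact_mod_cast hj2
            nlinarith
        _ = 2 * √((k : ℝ) + 1) := by
            rw [Real.sqrt_mul (by positivity), Real.sqrt_sq (by norm_num)]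
    calc a i ^ p ≤ ((2 ^ m) ^ j * Y) ^ p := Real.rpow_le_rpow (ha0 i) h1 hp0.le
      _ = √(2 ^ j) * Y ^ p := by rw [Real.mul_rpow (by positivity) hY, h2]
      _ = √(2 ^ j) * √((i : ℝ) + 1) * Y ^ p * (√((i : ℝ) + 1))⁻¹ := by field_simp
      _ ≤ _ := by gcongr
  refine (Finset.sum_le_sum hterm).trans ?_
  rw [← Finset.mul_sum]
  have h4 := sum_range_inv_sqrt_le (k + 1)
  push_cast at h4
  have hYp : 0 ≤ Y ^ p := Real.rpow_nonneg hY p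
  calc 2 * √((k : ℝ) + 1) * Y ^ p * ∑ i ∈ Finset.range (k + 1), (√((i : ℝ) + 1))⁻¹
      ≤ 2 * √((k : ℝ) + 1) * Y ^ p * (2 * √((k : ℝ) + 1)) := by gcongr
    _ = 4 * (√((k : ℝ) + 1) * √((k : ℝ) + 1)) * Y ^ p := by ring
    _ = 4 * (k + 1) * Y ^ p := by rw [Real.mul_self_sqrt (by positivity)]

/-- Weak-type estimate: deleting the `n` largest terms of an `ℓ^p` sequence leaves a small
`ℓ^q` remainder. -/
theorem exists_sumOff_le_of_tsum_rpow_le {p q : ℝ} (hp : 0 < p) (hpq : p ≤ q) {x : ℕ → ℝ≥0∞}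
    {P : ℝ≥0∞} (hP : P ≠ ∞) (hx : ∑' k, x k ^ p ≤ P) {n : ℕ} (hn : n ≠ 0) :
    ∃ F : Finset ℕ, F.card ≤ n ∧ sumOff (fun k => x k ^ q) F ≤ n * (P / n) ^ (q / p) := by
  have hq : 0 < q := hp.trans_le hpq
  have hn0 : (n : ℝ≥0∞) ≠ 0 := by exact_mod_cast hn
  have hnt : (n : ℝ≥0∞) ≠ ∞ := ENNReal.natCast_ne_top n
  by_cases hP0 : P = 0
  · refine ⟨∅, by simp, ?_⟩
    have h0 : ∀ k, x k = 0 := by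
      rw [hP0, nonpos_iff_eq_zero, ENNReal.tsum_eq_zero] at hx
      intro k
      simpa [hp, hp.not_gt] using hx k
    simp [sumOff_empty, h0, hq]
  have hε : P / n ≠ 0 := ENNReal.div_ne_zero.2 ⟨hP0, hnt⟩
  -- Chebyshev at level `P / n`: at most `n` of the `p`-th powers reach it, and these are the
  -- deleted terms.
  obtain ⟨hfin, hcard⟩ := ENNReal.finset_card_const_le_le_of_tsum_le hP hx hε
  have hdiv : P / (P / n) = n := by
    rw [ENNReal.div_eq_inv_mul, ENNReal.inv_div (Or.inl hnt) (Or.inl hn0),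
      ENNReal.div_mul_cancel hP0 hP]
  refine ⟨hfin.toFinset, ?_, ?_⟩
  · rw [hdiv] at hcard
    exact_mod_cast hcard
  · have hr : 0 ≤ q / p - 1 := by
      rw [sub_nonneg]
      exact (one_le_div hp).2 hpq
    have hsplit : ∀ z : ℝ≥0∞, z ^ (q / p) = z ^ (q / p - 1) * z := fun z => by
      conv_rhs => rw [← ENNReal.rpow_one z, ← ENNReal.rpow_mul, one_mul,
        ← ENNReal.rpow_add_of_nonneg _ _ hr zero_le_one, sub_add_cancel]
    calc sumOff (fun k => x k ^ q) hfin.toFinset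
        ≤ ∑' k, (P / n) ^ (q / p - 1) * x k ^ p := by
          refine ENNReal.tsum_le_tsum fun k => ?_
          by_cases hk : k ∈ hfin.toFinset
          · rw [Set.indicator_of_notMem (by simpa using hk)]
            exact zero_le
          · rw [Set.indicator_of_mem (by simpa using hk)]
            have hk' : x k ^ p ≤ P / n := by
              rw [Set.Finite.mem_toFinset] at hk
              exact (not_le.1 hk).le
            calc x k ^ q = (x k ^ p) ^ (q / p) := by
                  rw [← ENNReal.rpow_mul, mul_div_cancel₀ _ hp.ne']
              _ = (x k ^ p) ^ (q / p - 1) * x k ^ p := hsplit _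
              _ ≤ _ := by gcongr
      _ = (P / n) ^ (q / p - 1) * ∑' k, x k ^ p := ENNReal.tsum_mul_left
      _ ≤ (P / n) ^ (q / p - 1) * P := by gcongr
      _ = n * (P / n) ^ (q / p) := by
          rw [hsplit (P / n), mul_left_comm, ENNReal.mul_div_cancel hn0 hnt]

/-- If a sequence is bounded below by a constant on `[n, 3 * n)`, then at least `n` such terms
survive the deletion of `n` terms. -/
theorem mul_le_sumOff_of_le {φ : ℕ → ℝ≥0∞} {n : ℕ} {t : ℝ≥0∞}
    (h : ∀ k, n ≤ k → k < 3 * n → t ≤ φ k) {F : Finset ℕ} (hF : F.card ≤ n) :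
    n * t ≤ sumOff φ F := by
  classical
  have hcard : n ≤ (Finset.Ico n (3 * n) \ F).card := by
    have := Finset.le_card_sdiff F (Finset.Ico n (3 * n))
    rw [Nat.card_Ico] at this
    omega
  calc (n : ℝ≥0∞) * t ≤ (Finset.Ico n (3 * n) \ F).card • t := by
        rw [nsmul_eq_mul]
        gcongr
    _ ≤ ∑ k ∈ Finset.Ico n (3 * n) \ F, ((F : Set ℕ)ᶜ).indicator φ k := by
        refine Finset.card_nsmul_le_sum _ _ _ fun k hk => ?_
        rw [Finset.mem_sdiff, Finset.mem_Ico] at hk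
        rw [Set.indicator_of_mem (by simpa using hk.2)]
        exact h k hk.1.1 hk.1.2
    _ ≤ sumOff φ F := ENNReal.sum_le_tsum _

end SeqInterp

/-! ### From uniform tail closedness to interpolation: (b) ⇒ (a) -/

namespace SeqInterp

open Filter Topology

variable {𝕜 : Type*} [RCLike 𝕜] {E : NormedSeqSpace 𝕜} {q c : ℝ}

/-- Sequences whose `q`-th powers are tail dominated by those of an element `u` of `E` belong to `E`,
with quasi-norm at most `c` times that of `u`. -/
def NormedSeqSpace.IsTailClosed (E : NormedSeqSpace 𝕜) (q c : ℝ) : Prop :=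
  ∀ u ∈ E.carrier, ∀ v : ℕ → 𝕜, TailDominated (fun k => ‖v k‖ₑ ^ q) (fun k => ‖u k‖ₑ ^ q) →
    v ∈ E.carrier ∧ E.nm v ≤ c * E.nm u

namespace NormedSeqSpace.IsTailClosed

theorem mem_and_nm_le_of_const_mul (hb : E.IsTailClosed q c) (hE : E.IsQuasiBanach) (hq : 0 < q)
    {y v : ℕ → 𝕜} (hy : y ∈ E.carrier) {Λ : ℝ≥0∞} (hΛ : Λ ≠ ∞)
    (h : TailDominated (fun k => ‖v k‖ₑ ^ q) fun k => Λ * ‖y k‖ₑ ^ q) :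
    v ∈ E.carrier ∧ E.nm v ≤ c * ((Λ ^ q⁻¹).toReal * E.nm y) := by
  have hΛ' : Λ ^ q⁻¹ ≠ ∞ := by finiteness
  have hn : ‖(((Λ ^ q⁻¹).toReal : ℝ) : 𝕜)‖ = (Λ ^ q⁻¹).toReal := by
    rw [RCLike.norm_ofReal, abs_of_nonneg ENNReal.toReal_nonneg]
  have he : ‖(((Λ ^ q⁻¹).toReal : ℝ) : 𝕜)‖ₑ ^ q = Λ := by
    rw [← ofReal_norm, hn, ENNReal.ofReal_toReal hΛ', ENNReal.rpow_inv_rpow hq.ne']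
  have := hb _ (E.carrier.smul_mem (((Λ ^ q⁻¹).toReal : ℝ) : 𝕜) hy) v (by
    rw [enorm_smul_rpow hq.le, he]
    exact h)
  rwa [hE.nm_smul _ hy, hn] at this

/-- Doubling every term is the sum of the spreadings of `u` to even and to odd positions, each tail
dominated by `u`; then iterate. -/
theorem exists_dilation_bound (hb : E.IsTailClosed q c) (hE : E.IsQuasiBanach) (hq : 0 < q) :
    ∃ L : ℝ, 1 ≤ L ∧ ∀ u ∈ E.carrier, ∀ j : ℕ,
      (fun k => u (k / 2 ^ j)) ∈ E.carrier ∧ E.nm (fun k => u (k / 2 ^ j)) ≤ L ^ j * E.nm u := by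
  obtain ⟨K, hK1, hK⟩ := hE.exists_add_const
  have hstep : ∀ u ∈ E.carrier, (fun k => u (k / 2)) ∈ E.carrier ∧
      E.nm (fun k => u (k / 2)) ≤ K * (c + c) * E.nm u := by
    intro u hu
    have h0 := hb u hu (fun k => if k % 2 = 0 then u (k / 2) else 0)
      (tailDominated_of_extend (τ := fun k => 2 * k) (fun a b h => by simpa using h)
        (fun k => by simp) (fun k hk => by
          have : k % 2 ≠ 0 := fun h => hk ⟨k / 2, by dsimp only; omega⟩
          simp [this, hq]))
    have h1 := hb u hu (fun k => if k % 2 = 1 then u (k / 2) else 0)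
      (tailDominated_of_extend (τ := fun k => 2 * k + 1) (fun a b h => by simpa using h)
        (fun k => by
          have e1 : (2 * k + 1) % 2 = 1 := by omega
          have e2 : (2 * k + 1) / 2 = k := by omega
          simp [e1, e2]) (fun k hk => by
          have : k % 2 ≠ 1 := fun h => hk ⟨k / 2, by dsimp only; omega⟩
          simp [this, hq]))
    have hadd : (fun k => u (k / 2)) = (fun k => if k % 2 = 0 then u (k / 2) else 0) +
        fun k => if k % 2 = 1 then u (k / 2) else 0 := by
      funext k
      rcases Nat.mod_two_eq_zero_or_one k with h | h <;> simp [h]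
    rw [hadd]
    refine ⟨E.carrier.add_mem h0.1 h1.1, (hK _ _ h0.1 h1.1).trans ?_⟩
    have := mul_le_mul_of_nonneg_left (add_le_add h0.2 h1.2) (show 0 ≤ K by linarith)
    linarith
  refine ⟨max 1 (K * (c + c)), le_max_left _ _, fun u hu j => ?_⟩
  induction j with
  | zero => simpa using hu
  | succ j ih =>
    have h1 := hstep _ ih.1
    have he : (fun k => u (k / 2 ^ (j + 1))) = fun k => u (k / 2 / 2 ^ j) := by
      funext k
      rw [Nat.div_div_eq_div_mul, pow_succ, mul_comm]
    rw [he]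
    refine ⟨h1.1, h1.2.trans ?_⟩
    calc K * (c + c) * E.nm (fun k => u (k / 2 ^ j))
        ≤ max 1 (K * (c + c)) * (max 1 (K * (c + c)) ^ j * E.nm u) := by
          refine mul_le_mul (le_max_right _ _) ih.2 (hE.nm_nonneg _) ?_
          exact zero_le_one.trans (le_max_left _ _)
      _ = _ := by ring

/-- For some small `p`, the `p`-averages of decreasing elements of `E` are controlled by elements
of `E` of comparable quasi-norm. -/
theorem exists_exponent_average_bound (hb : E.IsTailClosed q c) (hE : E.IsQuasiBanach) (hq : 1 ≤ q) :
    ∃ p : ℝ, 0 < p ∧ p < q ∧ ∃ B : ℝ, 0 ≤ B ∧ ∀ a ∈ E.carrier,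
      Antitone (fun k => ‖a k‖) → ∃ y ∈ E.carrier, E.nm y ≤ B * E.nm a ∧
        (∀ k, ‖a k‖ ≤ ‖y k‖) ∧ ∀ (n : ℕ) (F : Finset ℕ), n ≠ 0 → F.card ≤ n →
          n * ((∑ i ∈ Finset.range n, ‖a i‖ₑ ^ p) / n) ^ (q / p) ≤
            12 ^ (q / p) * sumOff (fun k => ‖y k‖ₑ ^ q) F := by
  have hq0 : 0 < q := by linarith
  obtain ⟨K, hK1, hK⟩ := hE.exists_add_const
  obtain ⟨L, hL1, hL⟩ := hb.exists_dilation_bound hE hq0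
  -- The damping `2 ^ (-m * j)` must beat the dilation growth `L ^ j` with the ratio `2 * K` that
  -- `exists_majorant` requires. The shift by one ensures `m > 0`.
  obtain ⟨m₀, hm₀⟩ := pow_unbounded_of_one_lt (2 * K * L) (one_lt_two : (1 : ℝ) < 2)
  set m := m₀ + 1 with hmdef
  have hm : 0 < m := Nat.succ_pos _
  have hmKL : 2 * K * L ≤ 2 ^ m :=
    hm₀.le.trans (pow_le_pow_right₀ one_le_two (Nat.le_succ _))
  have hm1 : (1 : ℝ) ≤ m := by exact_mod_cast hm
  set p : ℝ := 1 / (2 * (m : ℝ)) with hp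
  have hp0 : 0 < p := by positivity
  have hp1 : p < 1 := by
    rw [hp, div_lt_one (by positivity)]
    linarith
  refine ⟨p, hp0, hp1.trans_le hq, K * (2 * K), by positivity, fun a ha hanti => ?_⟩
  let x : ℕ → ℕ → 𝕜 := fun j => (((((2 : ℝ) ^ m) ^ j)⁻¹ : ℝ) : 𝕜) • fun k => a (k / 2 ^ j)
  have hxn : ∀ j, ‖(((((2 : ℝ) ^ m) ^ j)⁻¹ : ℝ) : 𝕜)‖ = (((2 : ℝ) ^ m) ^ j)⁻¹ := fun j => by
    rw [RCLike.norm_ofReal, abs_of_nonneg (by positivity)]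
  obtain ⟨y, hy, hyn, hdom⟩ := hE.exists_majorant hK1 hK (A := 2 * K * E.nm a) (x := x)
    (fun j => E.carrier.smul_mem _ (hL a ha j).1) (fun j => by
      have hKpos : 0 < 2 * K := by linarith
      simp only [x]
      rw [hE.nm_smul _ (hL a ha j).1, hxn]
      have h1 := (hL a ha j).2
      have h2 : (2 * K * L) ^ j ≤ ((2 : ℝ) ^ m) ^ j := by gcongr
      calc (((2 : ℝ) ^ m) ^ j)⁻¹ * E.nm (fun k => a (k / 2 ^ j))
          ≤ ((2 * K * L) ^ j)⁻¹ * (L ^ j * E.nm a) := by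
            gcongr
            exact hE.nm_nonneg _
        _ = 2 * K * E.nm a * ((2 * K) ^ (j + 1))⁻¹ := by
            rw [mul_pow (2 * K) L, pow_succ]
            field_simp)
  have hdom' : ∀ j k, ‖a (k / 2 ^ j)‖ ≤ (2 ^ m) ^ j * ‖y k‖ := by
    intro j k
    have := hdom j k
    simp only [x, Pi.smul_apply, norm_smul, hxn] at this
    rwa [inv_mul_le_iff₀ (by positivity)] at this
  refine ⟨y, hy, by linarith, fun k => by simpa using hdom' 0 k, fun n F hn hF => ?_⟩
  have hn0 : (n : ℝ≥0∞) ≠ 0 := by exact_mod_cast hn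
  have hnt : (n : ℝ≥0∞) ≠ ∞ := ENNReal.natCast_ne_top n
  -- The constant is `12 = 4 * 3`, since `k + 1 ≤ 3 * n`. The window has `2 * n` indices, so `n` of
  -- them survive any deletion of `n` terms.
  have havg : ∀ k, n ≤ k → k < 3 * n →
      (∑ i ∈ Finset.range n, ‖a i‖ₑ ^ p) / n ≤ 12 * ‖y k‖ₑ ^ p := by
    intro k hk hk'
    rw [ENNReal.div_le_iff hn0 hnt]
    have h1 := sum_rpow_le_of_dyadic_bound hanti (fun _ => norm_nonneg _) hm (norm_nonneg (y k))
      fun j => hdom' j k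
    rw [← hp] at h1
    have e : ∀ z : 𝕜, ‖z‖ₑ ^ p = ENNReal.ofReal (‖z‖ ^ p) := fun z => by
      rw [← ENNReal.ofReal_rpow_of_nonneg (norm_nonneg _) hp0.le, ofReal_norm]
    simp_rw [e]
    rw [← ENNReal.ofReal_sum_of_nonneg fun _ _ => by positivity]
    calc ENNReal.ofReal (∑ i ∈ Finset.range n, ‖a i‖ ^ p)
        ≤ ENNReal.ofReal (12 * ‖y k‖ ^ p * n) := by
          refine ENNReal.ofReal_le_ofReal ?_
          have h2 : ∑ i ∈ Finset.range n, ‖a i‖ ^ p ≤ ∑ i ∈ Finset.range (k + 1), ‖a i‖ ^ p :=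
            Finset.sum_le_sum_of_subset_of_nonneg (Finset.range_subset_range.2 (by omega))
              fun _ _ _ => by positivity
          refine h2.trans (h1.trans ?_)
          have h3 : (k : ℝ) + 1 ≤ 3 * n := by exact_mod_cast hk'
          have h4 : 0 ≤ ‖y k‖ ^ p := by positivity
          nlinarith
      _ = 12 * ENNReal.ofReal (‖y k‖ ^ p) * n := by
          rw [ENNReal.ofReal_mul (by positivity), ENNReal.ofReal_mul (by norm_num),
            ENNReal.ofReal_natCast]
          norm_num
  rw [← sumOff_const_mul]
  refine mul_le_sumOff_of_le (fun k hk hk' => ?_) hF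
  have hqp : 0 ≤ q / p := by positivity
  calc _ ≤ (12 * ‖y k‖ₑ ^ p) ^ (q / p) := ENNReal.rpow_le_rpow (havg k hk hk') hqp
    _ = 12 ^ (q / p) * ‖y k‖ₑ ^ q := by
      rw [ENNReal.mul_rpow_of_nonneg _ _ hqp, ← ENNReal.rpow_mul, mul_div_cancel₀ _ hp0.ne']

/-- Solidity yields some unit vector, and tail domination moves it to position `0`. -/
theorem single_mem (hb : E.IsTailClosed q c) (hE : E.IsQuasiBanach) (hne : E.carrier ≠ ⊥) :
    (Pi.single 0 (1 : 𝕜) : ℕ → 𝕜) ∈ E.carrier := by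
  obtain ⟨z, hz, hz0⟩ := Submodule.exists_mem_ne_zero_of_ne_bot hne
  obtain ⟨k, hk⟩ := Function.ne_iff.1 hz0
  have h1 : (Pi.single k (1 : 𝕜) : ℕ → 𝕜) ∈ E.carrier := by
    refine (hE.mem_and_nm_le (E.carrier.smul_mem (z k)⁻¹ hz) fun i => ?_).1
    by_cases hi : i = k
    · subst hi
      simp only [Pi.single_eq_same, Pi.smul_apply, smul_eq_mul]
      rw [inv_mul_cancel₀ hk]
    · rw [Pi.single_eq_of_ne hi, norm_zero]
      exact norm_nonneg _
  refine (hb _ h1 _ ?_).1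
  have := tailDominated_comp (fun i => ‖(Pi.single k (1 : 𝕜) : ℕ → 𝕜) i‖ₑ ^ q)
    (Equiv.swap 0 k).injective
  convert this using 4 with i
  by_cases hi : i = 0
  · subst hi
    simp
  · rw [Pi.single_eq_of_ne hi, Pi.single_eq_of_ne]
    intro h
    exact hi ((Equiv.swap 0 k).injective (by rw [h, Equiv.swap_apply_left]))

theorem exists_isInterpolationSpace (hb : E.IsTailClosed q c) (hE : E.IsQuasiBanach) (hq : 1 ≤ q)
    (hc : 0 < c) (hne : E.carrier ≠ ⊥) (hsum : ∀ u ∈ E.carrier, ∑' k, ‖u k‖ₑ ^ q ≠ ∞) :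
    ∃ p : ℝ, 0 < p ∧ p < q ∧
      IsInterpolationSpace (ellp 𝕜 (ENNReal.ofReal p)) (ellp 𝕜 (ENNReal.ofReal q)) E := by
  classical
  have hq0 : 0 < q := by linarith
  obtain ⟨p, hp0, hpq, B, hB0, hB⟩ := hb.exists_exponent_average_bound hE hq
  have hqp : 0 ≤ q / p := by positivity
  have hscale : ∀ (C S : ℝ≥0∞) (n : ℕ), (n : ℝ≥0∞) * (C * S / n) ^ (q / p) =
      C ^ (q / p) * (n * (S / n) ^ (q / p)) := fun C S n => by
    rw [mul_div_assoc, ENNReal.mul_rpow_of_nonneg _ _ hqp, mul_left_comm]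
  refine ⟨p, hp0, hpq, ?_, ?_, ?_⟩
  · rintro x ⟨hxp, hxq⟩
    have hP := (mem_ellp_iff hp0 x).1 hxp
    have hQ := (mem_ellp_iff hq0 x).1 hxq
    -- Averaging the unit vector gives an element of `E` whose tails decay no faster than the
    -- weak-type bound for `ℓ^p`, so a multiple of it tail-dominates `x`. The summand `Q` in `Λ`
    -- handles `F = ∅`.
    obtain ⟨y, hy, -, hay, havg⟩ := hB _ (hb.single_mem hE hne) (antitone_nat_of_succ_le fun k => by
      simp)
    set P := ∑' k, ‖x k‖ₑ ^ p
    set Q := ∑' k, ‖x k‖ₑ ^ q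
    refine (hb.mem_and_nm_le_of_const_mul hE hq0 hy (Λ := P ^ (q / p) * 12 ^ (q / p) + Q)
      (by finiteness) fun F => ?_).1
    rcases Nat.eq_zero_or_pos F.card with hF | hF
    · obtain rfl := Finset.card_eq_zero.1 hF
      refine ⟨∅, le_rfl, ?_⟩
      rw [sumOff_const_mul, sumOff_empty, sumOff_empty]
      have h1 : 1 ≤ ∑' k, ‖y k‖ₑ ^ q := by
        refine le_trans (ENNReal.one_le_rpow ?_ hq0) (ENNReal.le_tsum 0)
        have := hay 0
        simp only [Pi.single_eq_same, norm_one] at this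
        rw [← ofReal_norm]
        exact ENNReal.one_le_ofReal.2 this
      calc Q ≤ P ^ (q / p) * 12 ^ (q / p) + Q := le_add_self
        _ ≤ _ := le_mul_of_one_le_right zero_le h1
    · obtain ⟨F', hF', hle⟩ := exists_sumOff_le_of_tsum_rpow_le hp0 hpq.le hP le_rfl hF.ne'
      refine ⟨F', hF', hle.trans ?_⟩
      have h1 : ∑ i ∈ Finset.range F.card, ‖(Pi.single 0 (1 : 𝕜) : ℕ → 𝕜) i‖ₑ ^ p = 1 := by
        rw [Finset.sum_eq_single_of_mem 0 (Finset.mem_range.2 hF)]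
        · simp
        · intro i _ hi
          simp [hi, hp0]
      have h2 := havg F.card F hF.ne' le_rfl
      rw [h1] at h2
      rw [sumOff_const_mul]
      calc (F.card : ℝ≥0∞) * (P / F.card) ^ (q / p)
          = P ^ (q / p) * (F.card * (1 / F.card) ^ (q / p)) := by rw [← hscale, mul_one]
        _ ≤ P ^ (q / p) * (12 ^ (q / p) * sumOff (fun k => ‖y k‖ₑ ^ q) F) := by gcongr
        _ = P ^ (q / p) * 12 ^ (q / p) * sumOff (fun k => ‖y k‖ₑ ^ q) F := (mul_assoc _ _ _).symm
        _ ≤ _ := by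
          gcongr
          exact le_self_add
  · intro u hu
    exact Submodule.mem_sup_right ((mem_ellp_iff hq0 u).2 (hsum u hu))
  · intro T hTp hTq
    obtain ⟨Cp, hCp, hTp⟩ := (restrictsBounded_ellp_iff hp0 T).1 hTp
    obtain ⟨Cq, hCq, hTq⟩ := (restrictsBounded_ellp_iff hq0 T).1 hTq
    -- `2 ^ (q - 1)` comes from convexity of the `q`-th power applied to the two pieces of `T u`;
    -- the final `Cq` covers the case where nothing may be deleted.
    set Λ : ℝ≥0∞ := 2 ^ (q - 1) * (Cp ^ (q / p) * 12 ^ (q / p) + Cq) + Cq with hΛ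
    have hΛt : Λ ≠ ∞ := by
      have : (0 : ℝ) ≤ q - 1 := by linarith
      rw [hΛ]
      finiteness
    refine ⟨c * ((Λ ^ q⁻¹).toReal * (B * c)), fun u hu => ?_⟩
    have husum := hsum u hu
    obtain ⟨σ, hσ, hanti, hσ0, -⟩ := exists_decreasing_enumeration_norm hq0 husum
    have hσ0' : ∀ k, k ∉ Set.range σ → ‖(u : ℕ → 𝕜) k‖ₑ ^ q = 0 := fun k hk => by
      simp [hσ0 k hk, hq0]
    obtain ⟨haE, han⟩ := hb u hu (fun i => (u : ℕ → 𝕜) (σ i))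
      (tailDominated_comp (fun k => ‖(u : ℕ → 𝕜) k‖ₑ ^ q) hσ)
    obtain ⟨y, hy, hyn, hay, havg⟩ := hB _ haE hanti
    have hay' : ∀ k, ‖(u : ℕ → 𝕜) (σ k)‖ₑ ^ q ≤ ‖y k‖ₑ ^ q := fun k =>
      ENNReal.rpow_le_rpow (enorm_le_iff_norm_le.2 (hay k)) hq0.le
    have hdom : TailDominated (fun k => ‖(T u : ℕ → 𝕜) k‖ₑ ^ q) fun k => Λ * ‖y k‖ₑ ^ q := by
      intro F
      rcases Nat.eq_zero_or_pos F.card with hF | hF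
      · obtain rfl := Finset.card_eq_zero.1 hF
        refine ⟨∅, le_rfl, ?_⟩
        rw [sumOff_const_mul, sumOff_empty, sumOff_empty]
        refine (hTq u husum).trans (mul_le_mul' le_add_self ?_)
        rw [tsum_eq_tsum_comp_of_injective hσ hσ0']
        exact ENNReal.tsum_le_tsum hay'
      · set n := F.card with hn
        let G : Finset ℕ := (Finset.range n).image σ
        -- The split depends on the number of permitted deletions: `u₁` carries the `n` largest
        -- terms and is treated in `ℓ^p`; `u₂` carries the tail and is treated in `ℓ^q`.
        let u₁ : ℕ → 𝕜 := (G : Set ℕ).indicator u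
        let u₂ : ℕ → 𝕜 := ((G : Set ℕ)ᶜ).indicator u
        have hle₁ : ∀ k, ‖u₁ k‖ₑ ≤ ‖(u : ℕ → 𝕜) k‖ₑ := fun k => by
          by_cases hk : k ∈ G <;> simp [u₁, hk]
        have hle₂ : ∀ k, ‖u₂ k‖ₑ ≤ ‖(u : ℕ → 𝕜) k‖ₑ := fun k => by
          by_cases hk : k ∈ G <;> simp [u₂, hk]
        have hsum' : ∀ w : ℕ → 𝕜, (∀ k, ‖w k‖ₑ ≤ ‖(u : ℕ → 𝕜) k‖ₑ) → ∑' k, ‖w k‖ₑ ^ q ≠ ∞ :=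
          fun w hw => ne_top_of_le_ne_top husum
            (ENNReal.tsum_le_tsum fun k => ENNReal.rpow_le_rpow (hw k) hq0.le)
        have hV : ∀ w : ℕ → 𝕜, (∀ k, ‖w k‖ₑ ≤ ‖(u : ℕ → 𝕜) k‖ₑ) →
            w ∈ (ellp 𝕜 (ENNReal.ofReal p)).carrier ⊔ (ellp 𝕜 (ENNReal.ofReal q)).carrier :=
          fun w hw => Submodule.mem_sup_right ((mem_ellp_iff hq0 w).2 (hsum' w hw))
        have hsplit : u = ⟨u₁, hV u₁ hle₁⟩ + ⟨u₂, hV u₂ hle₂⟩ := by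
          ext k
          exact (congrFun (Set.indicator_self_add_compl (G : Set ℕ) (u : ℕ → 𝕜)) k).symm
        have hS₁ : ∑' k, ‖u₁ k‖ₑ ^ p = ∑ i ∈ Finset.range n, ‖(u : ℕ → 𝕜) (σ i)‖ₑ ^ p := by
          rw [tsum_eq_sum (s := G) fun k hk => by simp [u₁, hk, hp0],
            Finset.sum_image hσ.injOn]
          refine Finset.sum_congr rfl fun i hi => ?_
          simp only [u₁]
          rw [Set.indicator_of_mem]
          exact Finset.mem_coe.2 (Finset.mem_image_of_mem σ hi)
        have hS₁t : ∑' k, ‖u₁ k‖ₑ ^ p ≠ ∞ := by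
          rw [hS₁, ← lt_top_iff_ne_top, ENNReal.sum_lt_top]
          exact fun i _ => ENNReal.rpow_lt_top_of_nonneg hp0.le (by simp)
        have hS₂ : ∑' k, ‖u₂ k‖ₑ ^ q ≤ sumOff (fun k => ‖y k‖ₑ ^ q) F := by
          calc ∑' k, ‖u₂ k‖ₑ ^ q = sumOff (fun k => ‖(u : ℕ → 𝕜) k‖ₑ ^ q) G := by
                refine tsum_congr fun k => ?_
                by_cases hk : k ∈ G <;> simp [u₂, Set.indicator, hk, hq0]
            _ = ∑' i, ‖(u : ℕ → 𝕜) (σ (n + i))‖ₑ ^ q :=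
                sumOff_image_range (φ := fun k => ‖(u : ℕ → 𝕜) k‖ₑ ^ q) hσ hσ0' n
            _ ≤ sumOff (fun i => ‖(u : ℕ → 𝕜) (σ i)‖ₑ ^ q) F :=
                tsum_nat_add_le_sumOff (x := fun i => ‖(u : ℕ → 𝕜) (σ i)‖ₑ ^ q)
                  (fun i j hij => ENNReal.rpow_le_rpow (enorm_le_iff_norm_le.2 (hanti hij)) hq0.le)
                  hn.ge
            _ ≤ _ := sumOff_mono hay' F
        obtain ⟨F', hF', hle⟩ := exists_sumOff_le_of_tsum_rpow_le hp0 hpq.le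
          (ENNReal.mul_ne_top hCp hS₁t) (hTp ⟨u₁, hV u₁ hle₁⟩ hS₁t) hF.ne'
        refine ⟨F', hF', ?_⟩
        have h₁ : sumOff (fun k => ‖(T ⟨u₁, hV u₁ hle₁⟩ : ℕ → 𝕜) k‖ₑ ^ q) F' ≤
            Cp ^ (q / p) * 12 ^ (q / p) * sumOff (fun k => ‖y k‖ₑ ^ q) F := by
          refine hle.trans ?_
          rw [hscale, mul_assoc, hS₁]
          exact mul_le_mul_right (havg n F hF.ne' le_rfl) _
        have h₂ : sumOff (fun k => ‖(T ⟨u₂, hV u₂ hle₂⟩ : ℕ → 𝕜) k‖ₑ ^ q) F' ≤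
            Cq * sumOff (fun k => ‖y k‖ₑ ^ q) F :=
          (sumOff_le_tsum _ _).trans ((hTq ⟨u₂, hV u₂ hle₂⟩ (hsum' u₂ hle₂)).trans
            (mul_le_mul_right hS₂ _))
        have hpt : ∀ k, ‖(T u : ℕ → 𝕜) k‖ₑ ^ q ≤ 2 ^ (q - 1) *
            (‖(T ⟨u₁, hV u₁ hle₁⟩ : ℕ → 𝕜) k‖ₑ ^ q + ‖(T ⟨u₂, hV u₂ hle₂⟩ : ℕ → 𝕜) k‖ₑ ^ q) := by
          intro k
          have e : (T u : ℕ → 𝕜) k =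
              (T ⟨u₁, hV u₁ hle₁⟩ : ℕ → 𝕜) k + (T ⟨u₂, hV u₂ hle₂⟩ : ℕ → 𝕜) k := by
            conv_lhs => rw [hsplit, map_add]
            rfl
          rw [e]
          exact (ENNReal.rpow_le_rpow (enorm_add_le _ _) hq0.le).trans
            (ENNReal.rpow_add_le_mul_rpow_add_rpow _ _ hq)
        calc sumOff (fun k => ‖(T u : ℕ → 𝕜) k‖ₑ ^ q) F'
            ≤ 2 ^ (q - 1) * (sumOff (fun k => ‖(T ⟨u₁, hV u₁ hle₁⟩ : ℕ → 𝕜) k‖ₑ ^ q) F' +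
                sumOff (fun k => ‖(T ⟨u₂, hV u₂ hle₂⟩ : ℕ → 𝕜) k‖ₑ ^ q) F') := by
              refine (sumOff_mono hpt F').trans (le_of_eq ?_)
              rw [sumOff_const_mul, sumOff, sumOff, sumOff, ← ENNReal.tsum_add]
              congr 1
              exact tsum_congr fun k => congrFun (Set.indicator_add _ _ _) k
          _ ≤ 2 ^ (q - 1) * (Cp ^ (q / p) * 12 ^ (q / p) * sumOff (fun k => ‖y k‖ₑ ^ q) F +
                Cq * sumOff (fun k => ‖y k‖ₑ ^ q) F) := by gcongr
          _ = 2 ^ (q - 1) * (Cp ^ (q / p) * 12 ^ (q / p) + Cq) *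
                sumOff (fun k => ‖y k‖ₑ ^ q) F := by ring
          _ ≤ Λ * sumOff (fun k => ‖y k‖ₑ ^ q) F := by
              gcongr
              exact le_self_add
          _ = _ := (sumOff_const_mul _ _ _).symm
    obtain ⟨hTE, hTn⟩ := hb.mem_and_nm_le_of_const_mul hE hq0 hy hΛt hdom
    refine ⟨hTE, ?_⟩
    rw [← E.nm_of_mem hTE, ← E.nm_of_mem hu]
    calc E.nm (T u : ℕ → 𝕜) ≤ c * ((Λ ^ q⁻¹).toReal * E.nm y) := hTn
      _ ≤ c * ((Λ ^ q⁻¹).toReal * (B * (c * E.nm (u : ℕ → 𝕜)))) := by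
          gcongr
          exact hyn.trans (mul_le_mul_of_nonneg_left han hB0)
      _ = _ := by ring

end NormedSeqSpace.IsTailClosed

end SeqInterp

theorem mainTheorem2 {𝕜 : Type*} [RCLike 𝕜] (E : SeqInterp.NormedSeqSpace 𝕜)
    (hE : E.IsQuasiBanach)
    (hE_sub : E.carrier ≤ (SeqInterp.ellp 𝕜 ∞).carrier)
    (hE_ne_zero : E.carrier ≠ ⊥)
    (hE_ne_top : E.carrier ≠ (SeqInterp.ellp 𝕜 ∞).carrier)
    (q : ℝ) (hq : 1 ≤ q) :
    List.TFAE [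
      ∃ p : ℝ, 0 < p ∧ p < q ∧
        SeqInterp.IsInterpolationSpace (SeqInterp.ellp 𝕜 (ENNReal.ofReal p))
          (SeqInterp.ellp 𝕜 (ENNReal.ofReal q)) E,
      ∃ c : ℝ, 0 < c ∧ ∀ (u : E.carrier) (v : ℕ → 𝕜), v ∈ (SeqInterp.ellp 𝕜 ∞).carrier →
        SeqInterp.TailMajorizedPow q v u →
          ∃ hv : v ∈ E.carrier, E.qnorm ⟨v, hv⟩ ≤ c * E.qnorm u,
      ∀ (u : E.carrier) (v : ℕ → 𝕜), v ∈ (SeqInterp.ellp 𝕜 ∞).carrier →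
        SeqInterp.TailMajorizedPow q v u → v ∈ E.carrier] := by
  have hq0 : 0 < q := by linarith
  tfae_have 1 → 3 := by
    rintro ⟨p, hp, hpq, h⟩ u v - hvu
    exact h.mem_of_tailMajorizedPow hE hp hpq hq u.2 hvu
  tfae_have 3 → 2 := by
    intro hc
    have hmem : ∀ u ∈ E.carrier, ∀ v : ℕ → 𝕜, SeqInterp.TailDominated (fun k => ‖v k‖ₑ ^ q)
        (fun k => ‖u k‖ₑ ^ q) → v ∈ E.carrier := fun u hu v hvu =>
      hc ⟨u, hu⟩ v (SeqInterp.mem_ellp_top_of_tailDominated hq0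
        (SeqInterp.summable_of_closed_under_tailMajorization hq0 hE_sub hE_ne_top hc hu) hvu)
        ((SeqInterp.tailMajorizedPow_iff hq0.le _ _).2 hvu)
    obtain ⟨c, hc0, hb⟩ := SeqInterp.exists_bound_of_closed_under_tailDomination hE hq0 hmem
    refine ⟨c, hc0, fun u v _ hvu => ?_⟩
    rw [SeqInterp.tailMajorizedPow_iff hq0.le] at hvu
    have hv := hmem u u.2 v hvu
    refine ⟨hv, ?_⟩
    have := hb u u.2 v hvu
    rwa [E.nm_of_mem hv, E.nm_of_mem u.2] at this
  tfae_have 2 → 1 := by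
    rintro ⟨c, hc0, hb⟩
    have hsum : ∀ u ∈ E.carrier, ∑' k, ‖u k‖ₑ ^ q ≠ ∞ := fun u hu =>
      SeqInterp.summable_of_closed_under_tailMajorization hq0 hE_sub hE_ne_top
        (fun u v hv hvu => (hb u v hv hvu).1) hu
    have hclosed : E.IsTailClosed q c := by
      intro u hu v hvu
      obtain ⟨hv, hle⟩ := hb ⟨u, hu⟩ v
        (SeqInterp.mem_ellp_top_of_tailDominated hq0 (hsum u hu) hvu)
        ((SeqInterp.tailMajorizedPow_iff hq0.le _ _).2 hvu)
      refine ⟨hv, ?_⟩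
      rwa [E.nm_of_mem hv, E.nm_of_mem hu]
    exact hclosed.exists_isInterpolationSpace hE hq hc0 hE_ne_zero hsum
  tfae_finish
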